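/- Let $V$ be the $5$-dimensional space of real symmetric $3\times 3$ matrices $\sigma=(\sigma_{kl})$ with $\sigma_{22}=\sigma_{13}+\sigma_{31}=2\sigma_{13}$, with the basis $\sigma_1=2E_{11}$, $\sigma_2=E_{12}+E_{21}$, $\sigma_3=E_{13}+2E_{22}+E_{31}$, $\sigma_4=E_{23}+E_{32}$, $\sigma_5=2E_{33}$, where $E_{kl}$ are the matrix units. Let $W\subset\wedge^2V$ be the span of $\sigma_1\wedge\sigma_4-\sigma_2\wedge\sigma_3$, $\sigma_1\wedge\sigma_5-\sigma_2\wedge\sigma_4$ and $\sigma_2\wedge\sigma_5-\sigma_3\wedge\sigma_4$, and put $V'=(\wedge^2V)/W$. Let $\mathcal G=V\oplus V'$ be the $2$-step nilpotent Lie algebra in which $[v_1,v_2]=v_1\wedge v_2 \bmod W$ for $v_1,v_2\in V$ and $[x,y]=0$ for $x\in\mathcal G$, $y\in V'$, and let $G$ be the simply connected Lie group with Lie algebra $\mathcal G$. Its commutator subgroup $[G,G]$ is central and is identified with the vector space $V'$ by the exponential map. There is a set $E\subset[G,G]$ of Lebesgue measure $0$ such that for every $\theta\in[G,G]\setminus E$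 the quotient $G'=G/\Theta$ by the cyclic subgroup $\Theta$ generated by $\theta$ has the following properties, where $\mathrm{Aut}(G')$ denotes the group of continuous automorphisms of $G'$. 1. The commutator subgroup $[G',G']$ is closed in $G'$. 2. For every $\tau\in\mathrm{Aut}(G')$ the automorphism of $G'/[G',G']$ induced by $\tau$ is $I$ or $-I$, where $I$ is the identity and $-I$ is the map $x\mapsto x^{-1}$ of this abelian group. 3. For every $g\in G'\setminus[G',G']$ the $\mathrm{Aut}(G')$-orbit of $g$ is the union of the two distinct cosets $g[G',G']$ and $g^{-1}[G',G']$. Every $g\in[G',G']$ is fixed by $\mathrm{Aut}(G')$, so that its orbit is $\{g\}$. -/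

import Mathlib

open Matrix

namespace SmallAut

/-- The five-dimensional space of real symmetric `3 × 3` matrices with
`σ₂₂ = σ₁₃ + σ₃₁ = 2 σ₁₃` (indices of `Fin 3` start at `0`). -/
def V : Submodule ℝ (Matrix (Fin 3) (Fin 3) ℝ) where
  carrier := {M | Mᵀ = M ∧ M 1 1 = 2 * M 0 2}
  zero_mem' := by simp
  add_mem' := by
    rintro A B ⟨hA, hA'⟩ ⟨hB, hB'⟩
    refine ⟨by rw [transpose_add, hA, hB], ?_⟩
    simp only [Matrix.add_apply, hA', hB']
    ring
  smul_mem' := by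
    rintro c A ⟨hA, hA'⟩
    refine ⟨by rw [transpose_smul, hA], ?_⟩
    simp only [Matrix.smul_apply, smul_eq_mul, hA']
    ring

/-- `σ₁ = 2E₁₁`. -/
def σ₁ : V := ⟨!![2, 0, 0; 0, 0, 0; 0, 0, 0],
  by ext i j; fin_cases i <;> fin_cases j <;> simp, by simp⟩

/-- `σ₂ = E₁₂ + E₂₁`. -/
def σ₂ : V := ⟨!![0, 1, 0; 1, 0, 0; 0, 0, 0],
  by ext i j; fin_cases i <;> fin_cases j <;> simp, by simp⟩

/-- `σ₃ = E₁₃ + 2E₂₂ + E₃₁`. -/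
def σ₃ : V := ⟨!![0, 0, 1; 0, 2, 0; 1, 0, 0],
  by ext i j; fin_cases i <;> fin_cases j <;> simp, by simp⟩

/-- `σ₄ = E₂₃ + E₃₂`. -/
def σ₄ : V := ⟨!![0, 0, 0; 0, 0, 1; 0, 1, 0],
  by ext i j; fin_cases i <;> fin_cases j <;> simp, by simp⟩

/-- `σ₅ = 2E₃₃`. -/
def σ₅ : V := ⟨!![0, 0, 0; 0, 0, 0; 0, 0, 2],
  by ext i j; fin_cases i <;> fin_cases j <;> simp, by simp⟩

/-- `v ∧ w` in the second exterior power of `V`. -/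
noncomputable def wedge (v w : V) : ⋀[ℝ]^2 V := exteriorPower.ιMulti ℝ 2 ![v, w]

/-- The subspace `W` of `⋀² V` by which the free bracket is divided. -/
noncomputable def W : Submodule ℝ (⋀[ℝ]^2 V) :=
  Submodule.span ℝ {wedge σ₁ σ₄ - wedge σ₂ σ₃, wedge σ₁ σ₅ - wedge σ₂ σ₄,
    wedge σ₂ σ₅ - wedge σ₃ σ₄}

/-- `V' = (⋀² V) / W`. -/
abbrev V' : Type := (⋀[ℝ]^2 V) ⧸ W

theorem wedge_self (v : V) : wedge v v = 0 :=
  (exteriorPower.ιMulti ℝ 2).map_eq_zero_of_eq ![v, v] (i := 0) (j := 1) rfl (by simp)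

theorem update_zero_pair (u v w : V) : Function.update ![u, v] 0 w = ![w, v] := by
  ext i : 1
  fin_cases i <;> rfl

theorem update_one_pair (u v w : V) : Function.update ![u, v] 1 w = ![u, w] := by
  ext i : 1
  fin_cases i <;> rfl

theorem wedge_add_left (u v w : V) : wedge (u + v) w = wedge u w + wedge v w := by
  have := (exteriorPower.ιMulti ℝ 2 (M := V)).map_update_add ![u, w] 0 u v
  rwa [update_zero_pair, update_zero_pair, update_zero_pair] at this

theorem wedge_add_right (u v w : V) : wedge u (v + w) = wedge u v + wedge u w := by
  have := (exteriorPower.ιMulti ℝ 2 (M := V)).map_update_add ![u, v] 1 v w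
  rwa [update_one_pair, update_one_pair, update_one_pair] at this

theorem wedge_smul_left (c : ℝ) (v w : V) : wedge (c • v) w = c • wedge v w := by
  have := (exteriorPower.ιMulti ℝ 2 (M := V)).map_update_smul ![v, w] 0 c v
  rwa [update_zero_pair, update_zero_pair] at this

theorem wedge_smul_right (c : ℝ) (v w : V) : wedge v (c • w) = c • wedge v w := by
  have := (exteriorPower.ιMulti ℝ 2 (M := V)).map_update_smul ![v, w] 1 c w
  rwa [update_one_pair, update_one_pair] at this

/-- The bilinear map `(v, w) ↦ v ∧ w mod W`. -/
noncomputable def wedgeMod : V →ₗ[ℝ] V →ₗ[ℝ] V' :=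
  LinearMap.mk₂ ℝ (fun v w => W.mkQ (wedge v w))
    (fun u v w => by rw [wedge_add_left, map_add])
    (fun c v w => by rw [wedge_smul_left, map_smul])
    (fun u v w => by rw [wedge_add_right, map_add])
    (fun c v w => by rw [wedge_smul_right, map_smul])

theorem wedgeMod_self (v : V) : wedgeMod v v = 0 := by
  simp [wedgeMod, wedge_self]

/-- The vector space `V ⊕ V'` underlying the two-step nilpotent Lie algebra. -/
def NilAlg : Type := V × V'

noncomputable instance : AddCommGroup NilAlg := inferInstanceAs (AddCommGroup (V × V'))
noncomputable instance : Module ℝ NilAlg := inferInstanceAs (Module ℝ (V × V'))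
instance : Module.Finite ℝ NilAlg := inferInstanceAs (Module.Finite ℝ (V × V'))

/-- The Lie bracket: `[v₁, v₂] = v₁ ∧ v₂ mod W` on `V`, and `V'` is central. -/
noncomputable instance : Bracket NilAlg NilAlg where
  bracket x y := (0, wedgeMod x.1 y.1)

theorem bracket_fst (x y : NilAlg) : (⁅x, y⁆ : NilAlg).1 = 0 := rfl

theorem bracket_snd (x y : NilAlg) : (⁅x, y⁆ : NilAlg).2 = wedgeMod x.1 y.1 := rfl

theorem add_fst (x y : NilAlg) : (x + y).1 = x.1 + y.1 := rfl
theorem add_snd (x y : NilAlg) : (x + y).2 = x.2 + y.2 := rfl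
theorem neg_fst (x : NilAlg) : (-x).1 = -x.1 := rfl
theorem neg_snd (x : NilAlg) : (-x).2 = -x.2 := rfl
theorem smul_fst (c : ℝ) (x : NilAlg) : (c • x).1 = c • x.1 := rfl
theorem smul_snd (c : ℝ) (x : NilAlg) : (c • x).2 = c • x.2 := rfl
theorem zero_fst : (0 : NilAlg).1 = 0 := rfl
theorem zero_snd : (0 : NilAlg).2 = 0 := rfl

theorem NilAlg.ext {x y : NilAlg} (h₁ : x.1 = y.1) (h₂ : x.2 = y.2) : x = y :=
  Prod.ext h₁ h₂

noncomputable instance : LieRing NilAlg where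
  add_lie x y z := by
    apply NilAlg.ext <;> simp [bracket_fst, bracket_snd, add_fst, add_snd]
  lie_add x y z := by
    apply NilAlg.ext <;> simp [bracket_fst, bracket_snd, add_fst, add_snd]
  lie_self x := by
    apply NilAlg.ext <;> simp [bracket_fst, bracket_snd, zero_fst, zero_snd, wedgeMod_self]
  leibniz_lie x y z := by
    apply NilAlg.ext <;>
      simp only [bracket_fst, bracket_snd, add_fst, add_snd, map_zero, LinearMap.zero_apply,
        add_zero]

noncomputable instance : LieAlgebra ℝ NilAlg where
  lie_smul c x y := by
    apply NilAlg.ext <;> simp [bracket_fst, bracket_snd, smul_fst, smul_snd]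

theorem lie_lie_eq_zero (x y z : NilAlg) : ⁅x, ⁅y, z⁆⁆ = 0 := by
  apply NilAlg.ext <;>
    simp only [bracket_fst, bracket_snd, zero_fst, zero_snd, map_zero]

theorem lie_lie_eq_zero' (x y z : NilAlg) : ⁅⁅x, y⁆, z⁆ = 0 := by
  apply NilAlg.ext <;>
    simp only [bracket_fst, bracket_snd, zero_fst, zero_snd, map_zero, LinearMap.zero_apply]

/-- The simply connected nilpotent Lie group with Lie algebra `NilAlg`: the exponential map is
a homeomorphism from the Lie algebra, and the product is given by the
Baker–Campbell–Hausdorff formula, which for a two-step nilpotent Lie algebra reads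
`exp x * exp y = exp (x + y + ½ [x, y])`. -/
@[ext]
structure NilGroup : Type where
  exp ::
  /-- The inverse of the exponential map. -/
  log : NilAlg

namespace NilGroup

noncomputable instance : Mul NilGroup where
  mul g h := exp (g.log + h.log + (1 / 2 : ℝ) • ⁅g.log, h.log⁆)

noncomputable instance : One NilGroup where
  one := exp 0

noncomputable instance : Inv NilGroup where
  inv g := exp (-g.log)

theorem log_mul (g h : NilGroup) :
    (g * h).log = g.log + h.log + (1 / 2 : ℝ) • ⁅g.log, h.log⁆ := rfl

theorem log_one : (1 : NilGroup).log = 0 := rfl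

theorem log_inv (g : NilGroup) : (g⁻¹).log = -g.log := rfl

noncomputable instance : Group NilGroup :=
  Group.ofLeftAxioms
    (fun a b c => by
      ext
      simp only [log_mul, add_lie, lie_add, smul_lie, lie_smul, lie_lie_eq_zero,
        lie_lie_eq_zero', smul_add, smul_zero]
      abel)
    (fun a => by ext; simp [log_mul, log_one])
    (fun a => by ext; simp [log_mul, log_one, log_inv])

/-- The canonical topology of the finite-dimensional real vector space `NilAlg`, transported by
the exponential map. -/
noncomputable instance : TopologicalSpace NilGroup :=
  TopologicalSpace.induced log (moduleTopology ℝ NilAlg)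

/-- `exp` is a homeomorphism. -/
noncomputable def logHomeomorph :
    letI := moduleTopology ℝ NilAlg
    NilGroup ≃ₜ NilAlg :=
  letI := moduleTopology ℝ NilAlg
  { toFun := log
    invFun := exp
    left_inv := fun _ => rfl
    right_inv := fun _ => rfl
    continuous_toFun := continuous_induced_dom
    continuous_invFun := continuous_induced_rng.2 continuous_id }

instance : IsTopologicalGroup NilGroup := by
  let _ : TopologicalSpace NilAlg := moduleTopology ℝ NilAlg
  have : IsModuleTopology ℝ NilAlg := ⟨rfl⟩
  have := IsModuleTopology.topologicalAddGroup ℝ NilAlg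
  have hlog : Continuous log := logHomeomorph.continuous
  have := IsModuleTopology.toContinuousSMul ℝ NilAlg
  let B : NilAlg →ₗ[ℝ] NilAlg →ₗ[ℝ] NilAlg :=
    LinearMap.mk₂ ℝ (fun x y => ⁅x, y⁆) add_lie smul_lie lie_add lie_smul
  have hB : Continuous fun p : NilAlg × NilAlg => B p.1 p.2 :=
    IsModuleTopology.continuous_bilinear_of_finite_left B
  refine { continuous_mul := continuous_induced_rng.2 ?_,
           continuous_inv := continuous_induced_rng.2 ?_ }
  · have h₁ : Continuous fun p : NilGroup × NilGroup => p.1.log := hlog.comp continuous_fst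
    have h₂ : Continuous fun p : NilGroup × NilGroup => p.2.log := hlog.comp continuous_snd
    have h₃ : Continuous fun p : NilGroup × NilGroup => B p.1.log p.2.log :=
      Continuous.comp (g := fun p : NilAlg × NilAlg => B p.1 p.2)
        (f := fun p : NilGroup × NilGroup => (p.1.log, p.2.log)) hB (h₁.prodMk h₂)
    have h₄ : Continuous fun p : NilGroup × NilGroup => (1 / 2 : ℝ) • B p.1.log p.2.log :=
      h₃.const_smul (1 / 2 : ℝ)
    exact (h₁.add h₂).add h₄
  · exact hlog.neg

instance : SimplyConnectedSpace NilGroup := by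
  let _ : TopologicalSpace NilAlg := moduleTopology ℝ NilAlg
  have : IsModuleTopology ℝ NilAlg := ⟨rfl⟩
  have := IsModuleTopology.topologicalAddGroup ℝ NilAlg
  have : ContractibleSpace NilGroup := logHomeomorph.contractibleSpace
  infer_instance

/-- The group commutator corresponds to the Lie bracket. -/
theorem log_commutator (g h : NilGroup) :
    (g * h * g⁻¹ * h⁻¹).log = ⁅g.log, h.log⁆ := by
  simp only [log_mul, log_inv, add_lie, smul_lie, lie_lie_eq_zero', smul_zero,
    lie_neg, neg_lie, lie_self, zero_lie]
  have hs : ⁅h.log, g.log⁆ = -⁅g.log, h.log⁆ := (lie_skew _ _).symm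
  rw [hs]
  module

/-- The projection of `G` to `V`, a group homomorphism. -/
noncomputable def toV : NilGroup →* Multiplicative V where
  toFun g := Multiplicative.ofAdd g.log.1
  map_one' := rfl
  map_mul' g h := by
    rw [← ofAdd_add, log_mul, add_fst, add_fst, smul_fst, bracket_fst, smul_zero, add_zero]

/-- `[G, G]` is the image of `V'` under the exponential map. -/
theorem mem_commutator_iff (g : NilGroup) : g ∈ commutator NilGroup ↔ g.log.1 = 0 := by
  constructor
  · intro hg
    exact Multiplicative.ofAdd.injective
      (MonoidHom.mem_ker.1 (Abelianization.commutator_subset_ker toV hg))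
  · have key : ∀ x ∈ Submodule.span ℝ (Set.range (exteriorPower.ιMulti ℝ 2 (M := V))),
        ∀ c : ℝ, exp (0, W.mkQ (c • x)) ∈ commutator NilGroup := by
      intro x hx
      induction hx using Submodule.span_induction with
      | mem x hx =>
        obtain ⟨f, rfl⟩ := hx
        intro c
        have : exp (0, W.mkQ (c • exteriorPower.ιMulti ℝ 2 f)) =
            exp (c • f 0, 0) * exp (f 1, 0) * (exp (c • f 0, 0))⁻¹ * (exp (f 1, 0))⁻¹ := by
          ext1
          rw [log_commutator]
          apply NilAlg.ext
          · rfl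
          · change W.mkQ _ = W.mkQ (wedge (c • f 0) (f 1))
            rw [wedge_smul_left, wedge]
            have hf : f = ![f 0, f 1] := by
              ext i : 1
              fin_cases i <;> rfl
            rw [← hf]
        rw [this]
        exact Subgroup.commutator_mem_commutator (Subgroup.mem_top _) (Subgroup.mem_top _)
      | zero =>
        intro c
        rw [smul_zero, map_zero]
        exact one_mem _
      | add x y _ _ hx hy =>
        intro c
        have : exp (0, W.mkQ (c • (x + y))) =
            exp (0, W.mkQ (c • x)) * exp (0, W.mkQ (c • y)) := by
          ext1
          rw [log_mul]
          apply NilAlg.ext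
          · change (0 : V) = 0 + 0 + (1 / 2 : ℝ) • (0 : V)
            simp
          · change W.mkQ (c • (x + y)) =
              W.mkQ (c • x) + W.mkQ (c • y) + (1 / 2 : ℝ) • wedgeMod 0 0
            simp only [smul_add, map_add, map_zero, smul_zero, add_zero]
        rw [this]
        exact mul_mem (hx c) (hy c)
      | smul a x _ hx =>
        intro c
        rw [smul_smul]
        exact hx _
    intro hg
    obtain ⟨x, hx⟩ := W.mkQ_surjective g.log.2
    have h := key x (by rw [exteriorPower.ιMulti_span]; trivial) 1
    rw [one_smul, hx, ← hg] at h
    exact h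

theorem commutator_le_center : commutator NilGroup ≤ Subgroup.center NilGroup := by
  intro g hg
  rw [mem_commutator_iff] at hg
  rw [Subgroup.mem_center_iff]
  intro h
  ext1
  rw [log_mul, log_mul, add_comm g.log h.log]
  congr 2
  apply NilAlg.ext <;> simp [bracket_fst, bracket_snd, hg]

instance (θ : commutator NilGroup) : (Subgroup.zpowers (θ : NilGroup)).Normal := by
  have h : Subgroup.zpowers (θ : NilGroup) ≤ Subgroup.center NilGroup :=
    Subgroup.zpowers_le.2 (commutator_le_center θ.2)
  refine ⟨fun n hn g => ?_⟩
  rw [Subgroup.mem_center_iff.1 (h hn) g, mul_inv_cancel_right]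
  exact hn

end NilGroup

/-- A subset of `[G, G]` is Lebesgue-null if its image in the real vector space `V'` (to which
`[G, G]` is identified by the logarithm) has Lebesgue measure zero in linear coordinates. -/
def IsLebesgueNull (E : Set (commutator NilGroup)) : Prop :=
  MeasureTheory.volume
    ((fun θ : commutator NilGroup => (Module.finBasis ℝ V').equivFun (θ : NilGroup).log.2) '' E)
    = 0

/-- `G' = G / ⟨θ⟩`, with the quotient topology. -/
abbrev Quo (θ : commutator NilGroup) : Type := NilGroup ⧸ Subgroup.zpowers (θ : NilGroup)

/-- The automorphism of `G / [G, G]` induced by a continuous automorphism `τ` of a topological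
group `G`. -/
def factor {G : Type*} [Group G] [TopologicalSpace G] (τ : G ≃ₜ* G) :
    G ⧸ commutator G ≃* G ⧸ commutator G :=
  QuotientGroup.congr (commutator G) (commutator G) τ.toMulEquiv
    (Subgroup.characteristic_iff_map_eq.1 inferInstance τ.toMulEquiv)

/-- The orbit of `g` under the group of continuous automorphisms (with continuous inverse) of a
topological group `G`. -/
def autOrbit {G : Type*} [Group G] [TopologicalSpace G] (g : G) : Set G :=
  Set.range fun τ : G ≃ₜ* G => τ g

end SmallAut

open scoped Pointwise

/-!
A continuous automorphism of `G' = G / ⟨θ⟩` induces a linear automorphism `α` of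
`V = G' / [G', G']`. Since `W` is a real subspace while `⟨θ⟩` is countable, `⋀² α` preserves `W`,
and the map it induces on `V'` sends the logarithm `y` of `θ` to `n y` with an invertible
integer `n`.

The contraction of a bivector `ω ∈ W`, `ω ≠ 0`, with a linear form `φ` on `V` vanishes only if `φ`
is a multiple of `σ ↦ ᵗx σ x`, where `x ∈ ℝ³` is determined by `ω` up to scale. Hence `α` permutes
these forms up to scale, through an invertible matrix `γ` acting on `x`, and `ᵗγ α(σ) γ = μ σ` for a
constant `μ`. As `V` consists of the symmetric matrices orthogonal to `J`, such a `γ` is a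
similitude of the quadratic form `J`. On the null cone of `J` the cubic form
`x ↦ det (v x, w x, J x)` depends only on the class of `v ∧ w` in `V'`, so that `V'` maps to the
harmonic trilinear forms on `ℝ³`, compatibly with `α` and `γ`. A trilinear form has a matrix
covariant `N` and a vector covariant `L`; if `tr N ≠ 0` and `L, N L, N² L` are independent, then a
similitude preserving the form up to scale commutes with `N` and scales `L`, so it is scalar. The
exceptional `y` are the zeros of a nonzero polynomial and form a null set.

For the other `y` we get `α = a` with `a² = n`, so `n = 1` and `a = ±1`. Conversely, the
automorphisms `(v, y) ↦ (±v, y + β v)` of the Lie algebra, with `β : V → V'` linear, fix `θ` and act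
transitively on the union of `g [G', G']` and `g⁻¹ [G', G']` for `g` outside `[G', G']`.
-/

namespace SmallAut

section Wedge

variable {N : Type*} [AddCommGroup N] [Module ℝ N]

/-- The linear map on `⋀² V` induced by an alternating bilinear map on `V`. -/
noncomputable def wedgeLift (B : V →ₗ[ℝ] V →ₗ[ℝ] N) (hB : B.IsAlt) : ⋀[ℝ]^2 V →ₗ[ℝ] N :=
  exteriorPower.alternatingMapLinearEquiv
    { toFun := fun m => B (m 0) (m 1)
      map_update_add' := by
        intro _ m i x y
        fin_cases i <;> simp [Function.update]
      map_update_smul' := by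
        intro _ m i c x
        fin_cases i <;> simp [Function.update]
      map_eq_zero_of_eq' := by
        intro m i j hij hne
        have h01 : m 0 = m 1 := by fin_cases i <;> fin_cases j <;> simp_all
        rw [h01, hB] }

theorem wedgeLift_wedge (B : V →ₗ[ℝ] V →ₗ[ℝ] N) (hB : B.IsAlt) (v w : V) :
    wedgeLift B hB (wedge v w) = B v w := by
  simp [wedgeLift, wedge, exteriorPower.alternatingMapLinearEquiv_apply_ιMulti]

theorem ιMulti_eq_wedge (m : Fin 2 → V) : exteriorPower.ιMulti ℝ 2 m = wedge (m 0) (m 1) := by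
  rw [wedge]
  congr 1
  ext i : 1
  fin_cases i <;> rfl

theorem wedge_induction {p : ⋀[ℝ]^2 V → Prop} (zero : p 0)
    (add : ∀ ω η, p ω → p η → p (ω + η)) (wedge : ∀ v w, p (wedge v w)) (ω : ⋀[ℝ]^2 V) : p ω := by
  have hω : ω ∈ Submodule.span ℝ (Set.range (exteriorPower.ιMulti ℝ 2 (M := V))) := by
    rw [exteriorPower.ιMulti_span]
    trivial
  induction hω using Submodule.closure_induction with
  | zero => exact zero
  | add ω η _ _ hω hη => exact add ω η hω hη
  | smul_mem c ω hω =>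
    obtain ⟨m, rfl⟩ := hω
    rw [ιMulti_eq_wedge, ← wedge_smul_left]
    exact wedge _ _

theorem linearMap_ext_wedge {f g : ⋀[ℝ]^2 V →ₗ[ℝ] N}
    (h : ∀ v w, f (wedge v w) = g (wedge v w)) : f = g := by
  apply exteriorPower.linearMap_ext
  ext m
  simpa only [LinearMap.compAlternatingMap_apply, ιMulti_eq_wedge] using h (m 0) (m 1)

theorem map_wedge (α : V →ₗ[ℝ] V) (v w : V) :
    exteriorPower.map 2 α (wedge v w) = wedge (α v) (α w) := by
  rw [wedge, exteriorPower.map_apply_ιMulti, ιMulti_eq_wedge]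
  rfl

/-- The contraction `v ∧ w ↦ φ(v) w - φ(w) v` with a linear form `φ`. -/
noncomputable def contract (φ : V →ₗ[ℝ] ℝ) : ⋀[ℝ]^2 V →ₗ[ℝ] V :=
  wedgeLift
    (LinearMap.mk₂ ℝ (fun v w => φ v • w - φ w • v)
      (fun _ _ _ => by simp only [map_add]; module)
      (fun _ _ _ => by simp only [map_smul, smul_eq_mul]; module)
      (fun _ _ _ => by simp only [map_add]; module)
      (fun _ _ _ => by simp only [map_smul, smul_eq_mul]; module))
    fun v => by simp

theorem contract_wedge (φ : V →ₗ[ℝ] ℝ) (v w : V) :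
    contract φ (wedge v w) = φ v • w - φ w • v :=
  wedgeLift_wedge _ _ v w

theorem contract_map (φ : V →ₗ[ℝ] ℝ) (α : V →ₗ[ℝ] V) (ω : ⋀[ℝ]^2 V) :
    contract φ (exteriorPower.map 2 α ω) = α (contract (φ ∘ₗ α) ω) := by
  suffices h : contract φ ∘ₗ exteriorPower.map 2 α = α ∘ₗ contract (φ ∘ₗ α) from
    LinearMap.congr_fun h ω
  exact linearMap_ext_wedge fun v w => by simp [map_wedge, contract_wedge]

end Wedge

section Coordinates

theorem apply_comm (v : V) (i j : Fin 3) : v.1 i j = v.1 j i := congrFun₂ v.2.1 j i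

theorem apply_one_one (v : V) : v.1 1 1 = 2 * v.1 0 2 := v.2.2

theorem eq_sum_σ (v : V) : v = (v.1 0 0 / 2) • σ₁ + v.1 0 1 • σ₂ + v.1 0 2 • σ₃ +
    v.1 1 2 • σ₄ + (v.1 2 2 / 2) • σ₅ := by
  ext i j
  fin_cases i <;> fin_cases j <;>
    simp [σ₁, σ₂, σ₃, σ₄, σ₅, apply_comm v 1 0, apply_comm v 2 0, apply_comm v 2 1, apply_one_one]

theorem sum_smul_σ_eq_zero_iff {a b c d e : ℝ} :
    a • σ₁ + b • σ₂ + c • σ₃ + d • σ₄ + e • σ₅ = 0 ↔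
      a = 0 ∧ b = 0 ∧ c = 0 ∧ d = 0 ∧ e = 0 := by
  constructor
  · intro h
    have entry (i j : Fin 3) := congrFun₂ (congrArg Subtype.val h) i j
    simp only [σ₁, σ₂, σ₃, σ₄, σ₅] at entry
    exact ⟨by simpa using entry 0 0, by simpa using entry 0 1, by simpa using entry 0 2,
      by simpa using entry 1 2, by simpa using entry 2 2⟩
  · rintro ⟨rfl, rfl, rfl, rfl, rfl⟩
    simp

theorem linearForm_ext {φ ψ : V →ₗ[ℝ] ℝ} (h₁ : φ σ₁ = ψ σ₁) (h₂ : φ σ₂ = ψ σ₂)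
    (h₃ : φ σ₃ = ψ σ₃) (h₄ : φ σ₄ = ψ σ₄) (h₅ : φ σ₅ = ψ σ₅) : φ = ψ := by
  ext v
  rw [eq_sum_σ v]
  simp only [map_add, map_smul, h₁, h₂, h₃, h₄, h₅]

/-- Evaluation at `(x, y)` of the symmetric bilinear forms on `ℝ³` with matrices in `V`. -/
def formEval (x y : Fin 3 → ℝ) : V →ₗ[ℝ] ℝ where
  toFun v := x ⬝ᵥ v.1 *ᵥ y
  map_add' u v := by simp [add_mulVec]
  map_smul' c v := by simp [smul_mulVec]

theorem formEval_apply (x y : Fin 3 → ℝ) (v : V) : formEval x y v = x ⬝ᵥ v.1 *ᵥ y := rfl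

theorem formEval_self_σ (x : Fin 3 → ℝ) :
    formEval x x σ₁ = 2 * x 0 ^ 2 ∧ formEval x x σ₂ = 2 * x 0 * x 1 ∧
      formEval x x σ₃ = 2 * (x 0 * x 2 + x 1 ^ 2) ∧ formEval x x σ₄ = 2 * x 1 * x 2 ∧
      formEval x x σ₅ = 2 * x 2 ^ 2 := by
  refine ⟨?_, ?_, ?_, ?_, ?_⟩ <;>
    simp [formEval_apply, dotProduct, mulVec, Fin.sum_univ_three, σ₁, σ₂, σ₃, σ₄, σ₅] <;> ring

end Coordinates

section KernelParametrization

/-- The parametrization of `W` by `ℝ³`, with signs and order chosen so that the contraction of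
`omega x` with the linear form `formEval x x` vanishes. -/
noncomputable def omega : (Fin 3 → ℝ) →ₗ[ℝ] ⋀[ℝ]^2 V :=
  Fintype.linearCombination ℝ ![wedge σ₂ σ₅ - wedge σ₃ σ₄, -(wedge σ₁ σ₅ - wedge σ₂ σ₄),
    wedge σ₁ σ₄ - wedge σ₂ σ₃]

theorem range_omega : LinearMap.range omega = W := by
  rw [omega, Fintype.range_linearCombination, W]
  simp only [range_cons, range_empty, Set.union_empty, Set.singleton_union]
  rw [Submodule.span_insert, Submodule.span_insert, Submodule.span_insert, Submodule.span_insert,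
    ← Set.neg_singleton, Submodule.span_neg]
  rw [sup_comm, sup_comm (Submodule.span ℝ {wedge σ₁ σ₅ - wedge σ₂ σ₄}), sup_assoc]

theorem contract_omega_eq_zero_iff (φ : V →ₗ[ℝ] ℝ) (x : Fin 3 → ℝ) :
    contract φ (omega x) = 0 ↔
      x 1 * φ σ₅ - x 2 * φ σ₄ = 0 ∧ x 2 * φ σ₃ - x 1 * φ σ₄ - x 0 * φ σ₅ = 0 ∧
      x 0 * φ σ₄ - x 2 * φ σ₂ = 0 ∧ x 2 * φ σ₁ + x 1 * φ σ₂ - x 0 * φ σ₃ = 0 ∧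
      x 0 * φ σ₂ - x 1 * φ σ₁ = 0 := by
  rw [← sum_smul_σ_eq_zero_iff]
  simp only [omega, Fintype.linearCombination_apply, Fin.sum_univ_three, cons_val, map_add,
    map_sub, map_neg, map_smul, contract_wedge]
  rw [iff_iff_eq]
  congr 1
  module

theorem contract_formEval_omega (x : Fin 3 → ℝ) : contract (formEval x x) (omega x) = 0 := by
  obtain ⟨h₁, h₂, h₃, h₄, h₅⟩ := formEval_self_σ x
  rw [contract_omega_eq_zero_iff, h₁, h₂, h₃, h₄, h₅]
  refine ⟨?_, ?_, ?_, ?_, ?_⟩ <;> ring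

theorem exists_eq_smul_formEval {x : Fin 3 → ℝ} (hx : x ≠ 0) {φ : V →ₗ[ℝ] ℝ}
    (h : contract φ (omega x) = 0) : ∃ r : ℝ, φ = r • formEval x x := by
  obtain ⟨e₁, e₂, e₃, e₄, e₅⟩ := formEval_self_σ x
  rw [contract_omega_eq_zero_iff] at h
  obtain ⟨h₁, h₂, h₃, h₄, h₅⟩ := h
  suffices ∃ r : ℝ, φ σ₁ = r * (2 * x 0 ^ 2) ∧ φ σ₂ = r * (2 * x 0 * x 1) ∧
      φ σ₃ = r * (2 * (x 0 * x 2 + x 1 ^ 2)) ∧ φ σ₄ = r * (2 * x 1 * x 2) ∧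
      φ σ₅ = r * (2 * x 2 ^ 2) by
    obtain ⟨r, hr₁, hr₂, hr₃, hr₄, hr₅⟩ := this
    exact ⟨r, linearForm_ext (by simp [*]) (by simp [*]) (by simp [*]) (by simp [*])
      (by simp [*])⟩
  generalize φ σ₁ = p₁, φ σ₂ = p₂, φ σ₃ = p₃, φ σ₄ = p₄, φ σ₅ = p₅ at *
  by_cases hx₀ : x 0 = 0
  · by_cases hx₂ : x 2 = 0
    · have hx₁ : x 1 ≠ 0 := fun hx₁ => hx (by ext i; fin_cases i <;> assumption)
      have hp₁ : p₁ = 0 := by simpa [hx₀, hx₁] using h₅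
      have hp₂ : p₂ = 0 := by simpa [hx₀, hx₂, hx₁] using h₄
      have hp₄ : p₄ = 0 := by simpa [hx₀, hx₂, hx₁] using h₂
      have hp₅ : p₅ = 0 := by simpa [hx₂, hx₁] using h₁
      refine ⟨p₃ / (2 * x 1 ^ 2), ?_⟩
      simp [*]
    · have hp₄ : p₄ = x 1 * p₅ / x 2 := by field_simp; linarith
      have hp₃ : p₃ = x 1 * p₄ / x 2 := by rw [hx₀, zero_mul, sub_zero] at h₂; field_simp; linarith
      have hp₂ : p₂ = 0 := by simpa [hx₀, hx₂] using h₃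
      have hp₁ : p₁ = 0 := by simpa [hx₀, hx₂, hp₂] using h₄
      refine ⟨p₅ / (2 * x 2 ^ 2), ?_, ?_, ?_, ?_, ?_⟩ <;> grind
  · have hp₂ : p₂ = x 1 * p₁ / x 0 := by field_simp; linarith
    have hp₃ : p₃ = (x 2 * p₁ + x 1 * p₂) / x 0 := by field_simp; linarith
    have hp₄ : p₄ = x 2 * p₂ / x 0 := by field_simp; linarith
    have hp₅ : p₅ = (x 2 * p₃ - x 1 * p₄) / x 0 := by field_simp; linarith
    refine ⟨p₁ / (2 * x 0 ^ 2), ?_, ?_, ?_, ?_, ?_⟩ <;> grind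

theorem omega_injective : Function.Injective omega := by
  rw [← LinearMap.ker_eq_bot, LinearMap.ker_eq_bot']
  intro x hx
  have h (φ : V →ₗ[ℝ] ℝ) := (contract_omega_eq_zero_iff φ x).1 (by rw [hx, map_zero])
  obtain ⟨-, -, -, h₂, h₁⟩ := h (formEval ![1, 0, 0] ![1, 0, 0])
  obtain ⟨-, h₀, -, -, -⟩ := h (formEval ![0, 0, 1] ![0, 0, 1])
  ext i
  fin_cases i
  · simpa [formEval_self_σ] using h₀
  · simpa [formEval_self_σ] using h₁
  · simpa [formEval_self_σ] using h₂

theorem exists_injective_comp_eq {K M N : Type*} [Field K] [AddCommGroup M] [Module K M]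
    [AddCommGroup N] [Module K N] {f : M →ₗ[K] N} (hf : Function.Injective f) {T : N →ₗ[K] N}
    (hT : Function.Injective T) (hrange : LinearMap.range f ≤ (LinearMap.range f).comap T) :
    ∃ g : M →ₗ[K] M, Function.Injective g ∧ ∀ x, f (g x) = T (f x) := by
  obtain ⟨p, hp⟩ := f.exists_leftInverse_of_injective (LinearMap.ker_eq_bot.2 hf)
  have hfg (x : M) : f (p (T (f x))) = T (f x) := by
    obtain ⟨y, hy⟩ := hrange ⟨x, rfl⟩
    rw [← hy, show p (f y) = y from LinearMap.congr_fun hp y]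
  refine ⟨p ∘ₗ T ∘ₗ f, fun x y hxy => hf (hT ?_), hfg⟩
  rw [← hfg x, ← hfg y]
  exact congrArg f hxy

theorem exists_matrix_omega (α : V ≃ₗ[ℝ] V)
    (hα : W ≤ W.comap (exteriorPower.map 2 α.toLinearMap)) :
    ∃ γ : Matrix (Fin 3) (Fin 3) ℝ, IsUnit γ ∧
      ∀ x, omega (γ *ᵥ x) = exteriorPower.map 2 α.toLinearMap (omega x) := by
  have hmap : Function.Injective (exteriorPower.map 2 α.toLinearMap) :=
    exteriorPower.map_injective α.symm.toLinearMap (by ext; simp)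
  rw [← range_omega] at hα
  obtain ⟨g, hg, hgω⟩ := exists_injective_comp_eq omega_injective hmap hα
  refine ⟨LinearMap.toMatrix' g, ?_, fun x => by rw [LinearMap.toMatrix'_mulVec, hgω]⟩
  rw [← mulVec_injective_iff_isUnit]
  rwa [show (LinearMap.toMatrix' g).mulVec = g from funext (LinearMap.toMatrix'_mulVec g)]

end KernelParametrization

section Congruence

/-- The symmetric matrix spanning the orthogonal complement of `V` for the trace form on symmetric
matrices. -/
def J : Matrix (Fin 3) (Fin 3) ℝ := !![0, 0, -1; 0, 1, 0; -1, 0, 0]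

theorem J_mul_J : J * J = 1 := by
  simp [J, Matrix.one_fin_three]

theorem transpose_J : Jᵀ = J := by
  ext i j
  fin_cases i <;> fin_cases j <;> rfl

theorem trace_J_mul (M : Matrix (Fin 3) (Fin 3) ℝ) :
    trace (J * M) = M 1 1 - M 2 0 - M 0 2 := by
  simp only [trace_fin_three, Matrix.mul_apply, Fin.sum_univ_three, J, of_apply, cons_val]
  ring

theorem trace_J_mul_coe (v : V) : trace (J * v.1) = 0 := by
  rw [trace_J_mul, apply_one_one, apply_comm v 2 0]
  ring

theorem eq_smul_J_of_trace_mul_eq_zero {S : Matrix (Fin 3) (Fin 3) ℝ} (hS : S.IsSymm)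
    (h : ∀ v : V, trace (S * v.1) = 0) : S = S 1 1 • J := by
  have htrace (v : V) : trace (S * v.1) = S 0 0 * v.1 0 0 + S 1 1 * v.1 1 1 + S 2 2 * v.1 2 2 +
      2 * (S 0 1 * v.1 0 1 + S 0 2 * v.1 0 2 + S 1 2 * v.1 1 2) := by
    simp only [trace_fin_three, Matrix.mul_apply, Fin.sum_univ_three, hS.apply 0 1, hS.apply 0 2,
      hS.apply 1 2, apply_comm v 1 0, apply_comm v 2 0, apply_comm v 2 1]
    ring
  simp only [htrace] at h
  have h₀₀ : S 0 0 = 0 := by simpa [σ₁] using h σ₁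
  have h₀₁ : S 0 1 = 0 := by simpa [σ₂] using h σ₂
  have h₀₂ : S 1 1 * 2 + 2 * S 0 2 = 0 := by simpa [σ₃] using h σ₃
  have h₁₂ : S 1 2 = 0 := by simpa [σ₄] using h σ₄
  have h₂₂ : S 2 2 = 0 := by simpa [σ₅] using h σ₅
  ext i j
  fin_cases i <;> fin_cases j <;>
    simp [J, hS.apply 0 1, hS.apply 0 2, hS.apply 1 2] <;> linarith

theorem formEval_eq_trace (x y : Fin 3 → ℝ) (v : V) :
    formEval x y v = trace (vecMulVec y x * v.1) := by
  rw [formEval_apply, vecMulVec_mul, trace_vecMulVec, dotProduct_mulVec, dotProduct_comm]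

theorem formEval_comm (x y : Fin 3 → ℝ) : formEval x y = formEval y x := by
  ext v
  rw [formEval_apply, formEval_apply, dotProduct_mulVec, ← mulVec_transpose, v.2.1,
    dotProduct_comm]

theorem formEval_sum_eq_zero {x y : Fin 3 → ℝ} (hxy : x ⨯₃ y ≠ 0) {a b c : ℝ}
    (h : a • formEval x x + b • formEval x y + c • formEval y y = 0) : a = 0 := by
  set S := (2 * a) • vecMulVec x x + b • (vecMulVec x y + vecMulVec y x) + (2 * c) • vecMulVec y y
    with hS
  have hSJ : S = S 1 1 • J := by
    refine eq_smul_J_of_trace_mul_eq_zero ?_ fun v => ?_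
    · simp only [Matrix.IsSymm, hS, transpose_add, transpose_smul, transpose_vecMulVec]
      rw [add_comm (vecMulVec x y)]
    · have hv := LinearMap.congr_fun h v
      have hcomm := LinearMap.congr_fun (formEval_comm x y) v
      simp only [hS, add_mul, smul_mul_assoc, trace_add, trace_smul, ← formEval_eq_trace,
        LinearMap.add_apply, LinearMap.smul_apply, LinearMap.zero_apply, smul_eq_mul] at hv ⊢
      linear_combination 2 * hv - b * hcomm
  -- `S` has rank at most two, while `J` is invertible.
  have mulVec_S (u : Fin 3 → ℝ) : S *ᵥ u =
      (2 * a * (x ⬝ᵥ u) + b * (y ⬝ᵥ u)) • x + (b * (x ⬝ᵥ u) + 2 * c * (y ⬝ᵥ u)) • y := by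
    simp only [hS, add_mulVec, smul_mulVec, vecMulVec_mulVec, op_smul_eq_smul]
    module
  have hS₁₁ : S 1 1 = 0 := by
    have hker : S *ᵥ (x ⨯₃ y) = 0 := by
      rw [mulVec_S]
      simp
    rw [hSJ, smul_mulVec, smul_eq_zero] at hker
    refine hker.resolve_right fun hJ => hxy ?_
    rw [← one_mulVec (x ⨯₃ y), ← J_mul_J, ← mulVec_mulVec, hJ, mulVec_zero]
  set u := y ⨯₃ (x ⨯₃ y) with hu
  have hyu : y ⬝ᵥ u = 0 := dot_self_cross _ _
  have hxu : x ⬝ᵥ u ≠ 0 := by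
    rwa [hu, triple_product_permutation, triple_product_permutation, Ne,
      dotProduct_self_eq_zero]
  have hSu : S *ᵥ u = 0 := by rw [hSJ, hS₁₁, zero_smul, zero_mulVec]
  simpa [mulVec_S, add_dotProduct, smul_dotProduct, hyu, hxu] using congrArg (· ⬝ᵥ u) hSu

theorem formEval_add_self (x y : Fin 3 → ℝ) :
    formEval (x + y) (x + y) = formEval x x + (2 : ℝ) • formEval x y + formEval y y := by
  ext v
  have hcomm := LinearMap.congr_fun (formEval_comm x y) v
  simp only [formEval_apply, LinearMap.add_apply, LinearMap.smul_apply, mulVec_add,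
    dotProduct_add, add_dotProduct, smul_eq_mul] at hcomm ⊢
  linarith

theorem formEval_sub_self (x y : Fin 3 → ℝ) :
    formEval (x - y) (x - y) = formEval x x - (2 : ℝ) • formEval x y + formEval y y := by
  ext v
  have hcomm := LinearMap.congr_fun (formEval_comm x y) v
  simp only [formEval_apply, LinearMap.add_apply, LinearMap.sub_apply, LinearMap.smul_apply,
    mulVec_sub, dotProduct_sub, sub_dotProduct, smul_eq_mul] at hcomm ⊢
  linarith

section Ratio

variable {α : V →ₗ[ℝ] V} {γ : Matrix (Fin 3) (Fin 3) ℝ} {r : (Fin 3 → ℝ) → ℝ}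
  (h : ∀ x, formEval (γ *ᵥ x) (γ *ᵥ x) ∘ₗ α = r x • formEval x x)

include h in
theorem ratio_eq_of_cross_ne_zero {x y : Fin 3 → ℝ} (hxy : x ⨯₃ y ≠ 0) : r x = r y := by
  have parallelogram : r (x + y) • formEval (x + y) (x + y) + r (x - y) • formEval (x - y) (x - y) =
      (2 * r x) • formEval x x + (2 * r y) • formEval y y := by
    rw [← h, ← h, mul_smul, mul_smul, ← h, ← h, mulVec_add, mulVec_sub, formEval_add_self,
      formEval_sub_self]
    simp only [LinearMap.add_comp, LinearMap.sub_comp, LinearMap.smul_comp]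
    module
  rw [formEval_add_self, formEval_sub_self] at parallelogram
  have hx : r (x + y) + r (x - y) - 2 * r x = 0 := by
    apply formEval_sum_eq_zero hxy (b := 2 * r (x + y) - 2 * r (x - y))
      (c := r (x + y) + r (x - y) - 2 * r y)
    linear_combination (norm := module) parallelogram
  have hy : r (x + y) + r (x - y) - 2 * r y = 0 := by
    apply formEval_sum_eq_zero (?_ : y ⨯₃ x ≠ 0) (b := 2 * r (x + y) - 2 * r (x - y))
      (c := r (x + y) + r (x - y) - 2 * r x)
    · rw [formEval_comm y x]
      linear_combination (norm := module) parallelogram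
    · rwa [← cross_anticomm, neg_ne_zero]
  linarith

include h in
theorem exists_ratio_eq : ∃ μ : ℝ, ∀ x ≠ 0, r x = μ := by
  refine ⟨r ![1, 0, 0], fun x hx => ?_⟩
  by_cases hx₀ : x ⨯₃ ![1, 0, 0] = 0
  · have hx₁ : x ⨯₃ ![0, 1, 0] ≠ 0 := by
      contrapose hx
      ext i
      fin_cases i <;> simp_all [cross_apply]
    rw [ratio_eq_of_cross_ne_zero h hx₁]
    exact ratio_eq_of_cross_ne_zero h (by simp [cross_apply])
  · exact ratio_eq_of_cross_ne_zero h hx₀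

end Ratio

theorem eq_of_forall_dotProduct_mulVec {n K : Type*} [Fintype n] [Field K] [NeZero (2 : K)]
    {A B : Matrix n n K} (hA : A.IsSymm) (hB : B.IsSymm)
    (h : ∀ x, x ⬝ᵥ A *ᵥ x = x ⬝ᵥ B *ᵥ x) : A = B := by
  classical
  apply Matrix.toBilin'.injective
  apply LinearMap.BilinForm.ext_of_isSymm (isSymm_toBilin'_iff_isSymm.2 hA)
    (isSymm_toBilin'_iff_isSymm.2 hB)
  simpa only [toBilin'_apply'] using h

theorem mulVec_dotProduct_mulVec_mulVec {n R : Type*} [Fintype n] [CommRing R]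
    (γ M : Matrix n n R) (x y : n → R) :
    (γ *ᵥ x) ⬝ᵥ M *ᵥ (γ *ᵥ y) = x ⬝ᵥ (γᵀ * M * γ) *ᵥ y := by
  rw [← mulVec_mulVec, ← mulVec_mulVec, dotProduct_mulVec x, vecMul_transpose]

theorem formEval_mulVec (γ : Matrix (Fin 3) (Fin 3) ℝ) (x y : Fin 3 → ℝ) (v : V) :
    formEval (γ *ᵥ x) (γ *ᵥ y) v = x ⬝ᵥ (γᵀ * v.1 * γ) *ᵥ y :=
  mulVec_dotProduct_mulVec_mulVec γ v.1 x y

theorem exists_congruence {α : V →ₗ[ℝ] V} {γ : Matrix (Fin 3) (Fin 3) ℝ}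
    (h : ∀ x, x ≠ 0 → ∃ r : ℝ, formEval (γ *ᵥ x) (γ *ᵥ x) ∘ₗ α = r • formEval x x) :
    ∃ μ : ℝ, ∀ v, γᵀ * (α v).1 * γ = μ • v.1 := by
  have h' (x : Fin 3 → ℝ) : ∃ r : ℝ, formEval (γ *ᵥ x) (γ *ᵥ x) ∘ₗ α = r • formEval x x := by
    by_cases hx : x = 0
    · exact ⟨0, by ext; simp [hx, formEval_apply]⟩
    · exact h x hx
  choose r hr using h'
  obtain ⟨μ, hμ⟩ := exists_ratio_eq hr
  refine ⟨μ, fun v => eq_of_forall_dotProduct_mulVec ?_ ?_ fun x => ?_⟩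
  · rw [Matrix.IsSymm, transpose_mul, transpose_mul, transpose_transpose, (α v).2.1,
      Matrix.mul_assoc]
  · rw [Matrix.IsSymm, transpose_smul, v.2.1]
  · by_cases hx : x = 0
    · simp [hx]
    · rw [← formEval_mulVec, ← hμ x hx, smul_mulVec, dotProduct_smul]
      exact LinearMap.congr_fun (hr x) v

theorem exists_congruence_of_le_comap {α : V ≃ₗ[ℝ] V}
    (hα : W ≤ W.comap (exteriorPower.map 2 α.toLinearMap)) :
    ∃ (γ : Matrix (Fin 3) (Fin 3) ℝ) (μ : ℝ), IsUnit γ ∧ ∀ v, γᵀ * (α v).1 * γ = μ • v.1 := by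
  obtain ⟨γ, hγ, hω⟩ := exists_matrix_omega α hα
  obtain ⟨μ, hμ⟩ := exists_congruence (α := α.toLinearMap) (γ := γ) fun x hx => by
    apply exists_eq_smul_formEval hx
    apply α.injective
    rw [map_zero, ← contract_formEval_omega (γ *ᵥ x), hω, contract_map]
    rfl
  exact ⟨γ, μ, hγ, hμ⟩

section

variable {α : V ≃ₗ[ℝ] V} {γ : Matrix (Fin 3) (Fin 3) ℝ} {μ : ℝ} (hγ : IsUnit γ)
  (h : ∀ v, γᵀ * (α v).1 * γ = μ • v.1)

include hγ h

theorem congruence_scale_ne_zero : μ ≠ 0 := by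
  rintro rfl
  have hσ := h (α.symm σ₁)
  rw [zero_smul, α.apply_symm_apply, hγ.mul_left_eq_zero,
    ((isUnit_transpose γ).2 hγ).mul_right_eq_zero] at hσ
  simpa [σ₁] using congrFun₂ hσ 0 0

theorem exists_mul_J_mul_transpose_eq_smul : ∃ l : ℝ, l ≠ 0 ∧ γ * J * γᵀ = l • J := by
  have hJ : γ * J * γᵀ = (γ * J * γᵀ) 1 1 • J := by
    apply eq_smul_J_of_trace_mul_eq_zero
    · rw [Matrix.IsSymm, transpose_mul, transpose_mul, transpose_transpose, transpose_J,
        Matrix.mul_assoc]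
    · intro v
      have hv := h (α.symm v)
      rw [α.apply_symm_apply] at hv
      rw [Matrix.mul_assoc, Matrix.mul_assoc, trace_mul_comm, Matrix.mul_assoc, Matrix.mul_assoc,
        ← Matrix.mul_assoc γᵀ, hv, mul_smul_comm, trace_smul, trace_J_mul_coe, smul_zero]
  refine ⟨_, fun hl => ?_, hJ⟩
  rw [hl, zero_smul, ((isUnit_transpose γ).2 hγ).mul_left_eq_zero, hγ.mul_right_eq_zero] at hJ
  simpa [J] using congrFun₂ hJ 1 1

end

end Congruence

section CubicTensor

variable {n R : Type*} [Fintype n] [CommRing R]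

/-- Trilinear forms on `n → R`: the value of `F` at the basis vectors `k`, `i`, `j` is
`F k i j`. -/
abbrev CubicTensor (n R : Type*) := n → Matrix n n R

/-- The cubic form obtained by restricting a trilinear form to the diagonal. -/
def cubic (x : n → R) : CubicTensor n R →ₗ[R] R where
  toFun F := ∑ k, x k * (x ⬝ᵥ F k *ᵥ x)
  map_add' F G := by
    simp only [Pi.add_apply, add_mulVec, dotProduct_add, mul_add, Finset.sum_add_distrib]
  map_smul' c F := by
    simp only [Pi.smul_apply, smul_mulVec, dotProduct_smul, smul_eq_mul, RingHom.id_apply,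
      Finset.mul_sum, mul_left_comm]

theorem cubic_apply (x : n → R) (F : CubicTensor n R) :
    cubic x F = ∑ k, x k * (x ⬝ᵥ F k *ᵥ x) := rfl

/-- The pullback of trilinear forms along the linear map with matrix `γ`. -/
def pull (γ : Matrix n n R) : CubicTensor n R →ₗ[R] CubicTensor n R where
  toFun F k := ∑ m, γ m k • (γᵀ * F m * γ)
  map_add' F G := by
    ext1 k
    simp only [Pi.add_apply, Matrix.mul_add, Matrix.add_mul, smul_add, Finset.sum_add_distrib]
  map_smul' c F := by
    ext1 k
    simp only [Pi.smul_apply, mul_smul_comm, smul_mul_assoc, RingHom.id_apply, Finset.smul_sum]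
    exact Finset.sum_congr rfl fun _ _ => smul_comm _ _ _

theorem pull_apply (γ : Matrix n n R) (F : CubicTensor n R) (k : n) :
    pull γ F k = ∑ m, γ m k • (γᵀ * F m * γ) := rfl

theorem pull_apply_apply (γ : Matrix n n R) (F : CubicTensor n R) (k i j : n) :
    pull γ F k i j = ∑ m, ∑ a, ∑ b, γ m k * γ a i * γ b j * F m a b := by
  simp only [pull_apply, Matrix.sum_apply, Matrix.smul_apply, Matrix.mul_apply, smul_eq_mul,
    transpose_apply, Finset.mul_sum, Finset.sum_mul]
  refine Finset.sum_congr rfl fun m _ => ?_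
  rw [Finset.sum_comm]
  refine Finset.sum_congr rfl fun a _ => Finset.sum_congr rfl fun b _ => ?_
  ring

theorem cubic_pull (γ : Matrix n n R) (F : CubicTensor n R) (x : n → R) :
    cubic x (pull γ F) = cubic (γ *ᵥ x) F := by
  simp only [cubic_apply, pull_apply, mulVec_dotProduct_mulVec_mulVec, sum_mulVec, smul_mulVec,
    dotProduct_sum, dotProduct_smul, smul_eq_mul, Finset.mul_sum]
  rw [Finset.sum_comm]
  refine Finset.sum_congr rfl fun m _ => ?_
  rw [show (γ *ᵥ x) m = ∑ k, γ m k * x k from rfl, Finset.sum_mul]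
  exact Finset.sum_congr rfl fun k _ => by ring

/-- The symmetric trilinear forms whose trace with respect to the matrix `Q` vanishes. -/
def harmonic (Q : Matrix n n R) : Submodule R (CubicTensor n R) where
  carrier := {F | (∀ k i j, F k i j = F k j i) ∧ (∀ k i j, F k i j = F i k j) ∧
    ∀ k, trace (Q * F k) = 0}
  zero_mem' := by simp
  add_mem' := by
    rintro F G ⟨hF, hF', hFQ⟩ ⟨hG, hG', hGQ⟩
    refine ⟨fun k i j => ?_, fun k i j => ?_, fun k => ?_⟩
    · rw [Pi.add_apply, Matrix.add_apply, Matrix.add_apply, hF, hG]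
    · rw [Pi.add_apply, Pi.add_apply, Matrix.add_apply, Matrix.add_apply, hF', hG']
    · rw [Pi.add_apply, Matrix.mul_add, trace_add, hFQ, hGQ, add_zero]
  smul_mem' := by
    rintro c F ⟨hF, hF', hFQ⟩
    refine ⟨fun k i j => ?_, fun k i j => ?_, fun k => ?_⟩
    · rw [Pi.smul_apply, Matrix.smul_apply, Matrix.smul_apply, hF]
    · rw [Pi.smul_apply, Pi.smul_apply, Matrix.smul_apply, Matrix.smul_apply, hF']
    · rw [Pi.smul_apply, mul_smul_comm, trace_smul, hFQ, smul_zero]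

theorem pull_mem_harmonic {Q γ : Matrix n n R} {l : R} (hγ : γ * Q * γᵀ = l • Q)
    {F : CubicTensor n R} (hF : F ∈ harmonic Q) : pull γ F ∈ harmonic Q := by
  obtain ⟨hF, hF', hFQ⟩ := hF
  refine ⟨fun k i j => ?_, fun k i j => ?_, fun k => ?_⟩
  · rw [pull_apply_apply, pull_apply_apply]
    refine Finset.sum_congr rfl fun m _ => ?_
    rw [Finset.sum_comm]
    refine Finset.sum_congr rfl fun a _ => Finset.sum_congr rfl fun b _ => ?_
    rw [hF]
    ring
  · rw [pull_apply_apply, pull_apply_apply, Finset.sum_comm]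
    refine Finset.sum_congr rfl fun m _ => Finset.sum_congr rfl fun a _ =>
      Finset.sum_congr rfl fun b _ => ?_
    rw [hF']
    ring
  · simp only [pull_apply, Matrix.mul_sum, mul_smul_comm, trace_sum, trace_smul]
    refine Finset.sum_eq_zero fun m _ => ?_
    rw [← Matrix.mul_assoc, trace_mul_comm, ← Matrix.mul_assoc, ← Matrix.mul_assoc, hγ,
      smul_mul_assoc, trace_smul, hFQ, smul_zero, smul_zero]

end CubicTensor

section HarmonicTensor

/-- The parametrization of the trilinear forms on `ℝ³` which are harmonic with respect to `J`. -/
def tensor : (Fin 7 → ℝ) →ₗ[ℝ] CubicTensor (Fin 3) ℝ where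
  toFun c := ![!![5 * c 0, 5 * c 1, c 2; 5 * c 1, 2 * c 2, c 3; c 2, c 3, c 4],
    !![5 * c 1, 2 * c 2, c 3; 2 * c 2, 2 * c 3, 2 * c 4; c 3, 2 * c 4, 5 * c 5],
    !![c 2, c 3, c 4; c 3, 2 * c 4, 5 * c 5; c 4, 5 * c 5, 5 * c 6]]
  map_add' c d := by
    ext k i j
    fin_cases k <;> fin_cases i <;> fin_cases j <;> simp <;> ring
  map_smul' r c := by
    ext k i j
    fin_cases k <;> fin_cases i <;> fin_cases j <;> simp <;> ring

theorem tensor_apply (c : Fin 7 → ℝ) :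
    tensor c = ![!![5 * c 0, 5 * c 1, c 2; 5 * c 1, 2 * c 2, c 3; c 2, c 3, c 4],
      !![5 * c 1, 2 * c 2, c 3; 2 * c 2, 2 * c 3, 2 * c 4; c 3, 2 * c 4, 5 * c 5],
      !![c 2, c 3, c 4; c 3, 2 * c 4, 5 * c 5; c 4, 5 * c 5, 5 * c 6]] := rfl

theorem range_tensor : LinearMap.range tensor = harmonic J := by
  apply le_antisymm
  · rintro _ ⟨c, rfl⟩
    refine ⟨fun k i j => ?_, fun k i j => ?_, fun k => ?_⟩
    · fin_cases k <;> fin_cases i <;> fin_cases j <;> rfl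
    · fin_cases k <;> fin_cases i <;> fin_cases j <;> rfl
    · rw [trace_J_mul, tensor_apply]
      fin_cases k <;> simp <;> ring
  · rintro F ⟨symm, symm', trace_eq_zero⟩
    have h₀ := trace_eq_zero 0
    have h₁ := trace_eq_zero 1
    have h₂ := trace_eq_zero 2
    rw [trace_J_mul] at h₀ h₁ h₂
    refine ⟨![F 0 0 0 / 5, F 0 0 1 / 5, F 0 0 2, F 0 1 2, F 0 2 2, F 1 2 2 / 5, F 2 2 2 / 5], ?_⟩
    ext k i j
    fin_cases k <;> fin_cases i <;> fin_cases j <;> simp [tensor_apply] <;>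
      linarith [symm 0 0 1, symm 0 0 2, symm 0 1 2, symm 1 0 1, symm 1 0 2, symm 1 1 2, symm 2 0 1,
        symm 2 0 2, symm 2 1 2, symm' 0 1 0, symm' 0 1 1, symm' 0 1 2, symm' 0 2 0, symm' 0 2 1,
        symm' 0 2 2, symm' 1 2 0, symm' 1 2 1, symm' 1 2 2]

theorem dotProduct_J_mulVec (x : Fin 3 → ℝ) : x ⬝ᵥ J *ᵥ x = x 1 ^ 2 - 2 * x 0 * x 2 := by
  simp only [J, dotProduct, mulVec, Fin.sum_univ_three, of_apply, cons_val]
  ring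

theorem cubic_tensor_nullCone (c : Fin 7 → ℝ) (s t : ℝ) :
    cubic ![2 * s ^ 2, 2 * s * t, t ^ 2] (tensor c) =
      5 * (8 * c 0 * s ^ 6 + 24 * c 1 * s ^ 5 * t + 12 * c 2 * s ^ 4 * t ^ 2 +
        8 * c 3 * s ^ 3 * t ^ 3 + 6 * c 4 * s ^ 2 * t ^ 4 + 6 * c 5 * s * t ^ 5 + c 6 * t ^ 6) := by
  simp only [cubic_apply, tensor_apply, dotProduct, mulVec, Fin.sum_univ_three, of_apply, cons_val]
  ring

theorem eq_zero_of_cubic_nullCone_eq_zero {F : CubicTensor (Fin 3) ℝ} (hF : F ∈ harmonic J)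
    (h : ∀ x, x ⬝ᵥ J *ᵥ x = 0 → cubic x F = 0) : F = 0 := by
  rw [← range_tensor] at hF
  obtain ⟨c, rfl⟩ := hF
  have sextic (s t : ℝ) := (cubic_tensor_nullCone c s t).symm.trans <| h _ <| by
    rw [dotProduct_J_mulVec]
    simp only [cons_val]
    ring
  have h₁ := sextic 1 0
  have h₂ := sextic 0 1
  have h₃ := sextic 1 1
  have h₄ := sextic 1 (-1)
  have h₅ := sextic 1 2
  have h₆ := sextic 1 (-2)
  have h₇ := sextic 2 1
  rw [← map_zero tensor]
  congr 1
  ext i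
  fin_cases i <;> simp only [Fin.zero_eta, Fin.mk_one, Fin.reduceFinMk, Pi.zero_apply] <;> linarith

/-- The coordinates on `⋀² V` for which `tensor` of the coordinates of `v ∧ w` represents, on the
null cone of `J`, a multiple of the cubic form `x ↦ det (v x, w x, J x)`. -/
noncomputable def wedgeCoeffs : ⋀[ℝ]^2 V →ₗ[ℝ] (Fin 7 → ℝ) :=
  wedgeLift
    (LinearMap.mk₂ ℝ (fun v w => ![(v.1 0 0 * w.1 0 1 - v.1 0 1 * w.1 0 0) / 2,
        (v.1 0 0 * w.1 0 2 - v.1 0 2 * w.1 0 0) / 2,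
        (v.1 0 0 * w.1 1 2 - v.1 1 2 * w.1 0 0) / 2 + (v.1 0 1 * w.1 0 2 - v.1 0 2 * w.1 0 1),
        (v.1 0 0 * w.1 2 2 - v.1 2 2 * w.1 0 0) / 4 + (v.1 0 1 * w.1 1 2 - v.1 1 2 * w.1 0 1),
        (v.1 0 1 * w.1 2 2 - v.1 2 2 * w.1 0 1) / 2 + (v.1 0 2 * w.1 1 2 - v.1 1 2 * w.1 0 2),
        (v.1 0 2 * w.1 2 2 - v.1 2 2 * w.1 0 2) / 2,
        (v.1 1 2 * w.1 2 2 - v.1 2 2 * w.1 1 2) / 2])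
      (fun _ _ _ => by ext i; fin_cases i <;> simp <;> ring)
      (fun _ _ _ => by ext i; fin_cases i <;> simp <;> ring)
      (fun _ _ _ => by ext i; fin_cases i <;> simp <;> ring)
      (fun _ _ _ => by ext i; fin_cases i <;> simp <;> ring))
    fun v => by
      ext i
      fin_cases i <;> simp only [LinearMap.mk₂_apply] <;> simp <;> ring

theorem wedgeCoeffs_wedge (v w : V) : wedgeCoeffs (wedge v w) =
    ![(v.1 0 0 * w.1 0 1 - v.1 0 1 * w.1 0 0) / 2,
      (v.1 0 0 * w.1 0 2 - v.1 0 2 * w.1 0 0) / 2,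
      (v.1 0 0 * w.1 1 2 - v.1 1 2 * w.1 0 0) / 2 + (v.1 0 1 * w.1 0 2 - v.1 0 2 * w.1 0 1),
      (v.1 0 0 * w.1 2 2 - v.1 2 2 * w.1 0 0) / 4 + (v.1 0 1 * w.1 1 2 - v.1 1 2 * w.1 0 1),
      (v.1 0 1 * w.1 2 2 - v.1 2 2 * w.1 0 1) / 2 + (v.1 0 2 * w.1 1 2 - v.1 1 2 * w.1 0 2),
      (v.1 0 2 * w.1 2 2 - v.1 2 2 * w.1 0 2) / 2,
      (v.1 1 2 * w.1 2 2 - v.1 2 2 * w.1 1 2) / 2] :=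
  wedgeLift_wedge _ _ v w

theorem W_le_ker_wedgeCoeffs : W ≤ LinearMap.ker wedgeCoeffs := by
  refine Submodule.span_le.2 ?_
  rintro _ (rfl | rfl | rfl) <;>
  · simp only [SetLike.mem_coe, LinearMap.mem_ker, map_sub, wedgeCoeffs_wedge]
    ext i
    fin_cases i <;> simp [σ₁, σ₂, σ₃, σ₄, σ₅]
    try norm_num

theorem cubic_tensor_wedgeCoeffs {x : Fin 3 → ℝ} (hx : x ⬝ᵥ J *ᵥ x = 0) (v w : V) :
    cubic x (tensor (wedgeCoeffs (wedge v w))) =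
      -(5 / 2) * det (of ![v.1 *ᵥ x, w.1 *ᵥ x, J *ᵥ x]) := by
  rw [dotProduct_J_mulVec] at hx
  obtain ⟨a, b, c, rfl⟩ : ∃ a b c, x = ![a, b, c] :=
    ⟨x 0, x 1, x 2, by ext i; fin_cases i <;> rfl⟩
  simp only [cubic_apply, tensor_apply, wedgeCoeffs_wedge, det_fin_three, dotProduct, mulVec,
    Fin.sum_univ_three, of_apply, J, cons_val, apply_comm v 1 0, apply_comm v 2 0, apply_comm v 2 1,
    apply_one_one, apply_comm w 1 0, apply_comm w 2 0, apply_comm w 2 1] at hx ⊢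
  generalize v.1 0 0 = v₀₀, v.1 0 1 = v₀₁, v.1 0 2 = v₀₂, v.1 1 2 = v₁₂, v.1 2 2 = v₂₂,
    w.1 0 0 = w₀₀, w.1 0 1 = w₀₁, w.1 0 2 = w₀₂, w.1 1 2 = w₁₂, w.1 2 2 = w₂₂
  by_cases hc : c = 0
  · obtain rfl : b = 0 := by simpa [hc] using hx
    subst hc
    ring
  · obtain rfl : a = b ^ 2 / (2 * c) := by field_simp; linarith
    field_simp
    ring

theorem transpose_mul_J_mul {γ : Matrix (Fin 3) (Fin 3) ℝ} {l : ℝ} (hl : l ≠ 0)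
    (hJ : γ * J * γᵀ = l • J) : γᵀ * J * γ = l • J := by
  have right_inv : γ * (l⁻¹ • (J * γᵀ * J)) = 1 := by
    rw [mul_smul_comm, ← Matrix.mul_assoc, ← Matrix.mul_assoc, hJ, smul_mul_assoc, J_mul_J,
      inv_smul_smul₀ hl]
  have left_inv := mul_eq_one_comm.1 right_inv
  calc γᵀ * J * γ = (l • J) * ((l⁻¹ • (J * γᵀ * J)) * γ) := by
        simp only [smul_mul_assoc, mul_smul_comm, inv_smul_smul₀ hl, ← Matrix.mul_assoc, J_mul_J,
          Matrix.one_mul]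
    _ = l • J := by rw [left_inv, Matrix.mul_one]

theorem det_of_mulVec {n R : Type*} [Fintype n] [DecidableEq n] [CommRing R] (A : Matrix n n R)
    (u : n → n → R) : det (of fun i => A *ᵥ u i) = det A * det (of u) := by
  rw [← det_transpose A, mul_comm, ← det_mul]
  congr 1
  ext i j
  simp [Matrix.mul_apply, mulVec, dotProduct, mul_comm]

theorem det_mul_cubic_tensor_map_wedge {α : V →ₗ[ℝ] V} {γ : Matrix (Fin 3) (Fin 3) ℝ} {μ l : ℝ}
    (hJ : γᵀ * J * γ = l • J) (h : ∀ v, γᵀ * (α v).1 * γ = μ • v.1) {x : Fin 3 → ℝ}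
    (hx : x ⬝ᵥ J *ᵥ x = 0) (v w : V) :
    γ.det * cubic (γ *ᵥ x) (tensor (wedgeCoeffs (wedge (α v) (α w)))) =
      l * μ ^ 2 * cubic x (tensor (wedgeCoeffs (wedge v w))) := by
  have mulVec_eq {A B : Matrix (Fin 3) (Fin 3) ℝ} {c : ℝ} (hAB : γᵀ * A * γ = c • B) :
      γᵀ *ᵥ (A *ᵥ (γ *ᵥ x)) = c • B *ᵥ x := by
    rw [← smul_mulVec, ← hAB, ← mulVec_mulVec, ← mulVec_mulVec]
  have isotropic : (γ *ᵥ x) ⬝ᵥ J *ᵥ (γ *ᵥ x) = 0 := by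
    rw [mulVec_dotProduct_mulVec_mulVec, hJ, smul_mulVec, dotProduct_smul, hx, smul_zero]
  have hdet : γ.det * det (of ![(α v).1 *ᵥ (γ *ᵥ x), (α w).1 *ᵥ (γ *ᵥ x), J *ᵥ (γ *ᵥ x)]) =
      l * μ ^ 2 * det (of ![v.1 *ᵥ x, w.1 *ᵥ x, J *ᵥ x]) := by
    calc _ = det (of fun i j => ![μ, μ, l] i * of ![v.1 *ᵥ x, w.1 *ᵥ x, J *ᵥ x] i j) := by
          rw [← det_transpose, ← det_of_mulVec]
          congr 1
          ext i j
          fin_cases i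
          exacts [congrFun (mulVec_eq (h v)) j, congrFun (mulVec_eq (h w)) j,
            congrFun (mulVec_eq hJ) j]
      _ = _ := by
          rw [det_mul_column, Fin.prod_univ_three]
          simp only [cons_val]
          ring
  rw [cubic_tensor_wedgeCoeffs isotropic, cubic_tensor_wedgeCoeffs hx]
  linear_combination -(5 / 2) * hdet

theorem pull_tensor_wedgeCoeffs {α : V →ₗ[ℝ] V} {γ : Matrix (Fin 3) (Fin 3) ℝ} {μ l : ℝ}
    (hl : l ≠ 0) (hJ : γ * J * γᵀ = l • J) (h : ∀ v, γᵀ * (α v).1 * γ = μ • v.1)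
    (ω : ⋀[ℝ]^2 V) :
    γ.det • pull γ (tensor (wedgeCoeffs (exteriorPower.map 2 α ω))) =
      (l * μ ^ 2) • tensor (wedgeCoeffs ω) := by
  suffices hlin : γ.det • (pull γ ∘ₗ tensor ∘ₗ wedgeCoeffs ∘ₗ exteriorPower.map 2 α) =
      (l * μ ^ 2) • (tensor ∘ₗ wedgeCoeffs) from LinearMap.congr_fun hlin ω
  have tensor_mem (c : Fin 7 → ℝ) : tensor c ∈ harmonic J := range_tensor ▸ ⟨c, rfl⟩
  apply linearMap_ext_wedge
  intro v w
  simp only [LinearMap.smul_apply, LinearMap.comp_apply, map_wedge]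
  rw [← sub_eq_zero]
  apply eq_zero_of_cubic_nullCone_eq_zero
  · exact sub_mem (Submodule.smul_mem _ _ (pull_mem_harmonic hJ (tensor_mem _)))
      (Submodule.smul_mem _ _ (tensor_mem _))
  · intro x hx
    rw [map_sub, map_smul, map_smul, cubic_pull, sub_eq_zero]
    exact det_mul_cubic_tensor_map_wedge (transpose_mul_J_mul hl hJ) h hx v w

end HarmonicTensor

section Rigidity

section Covariants

variable {n R : Type*} [Fintype n] [CommRing R]

/-- The quadratic covariant `(i, j) ↦ tr (Q Fᵢ Q Fⱼ)` of a trilinear form. -/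
def gramMatrix (Q : Matrix n n R) (F : CubicTensor n R) : Matrix n n R :=
  of fun i j => trace (Q * F i * (Q * F j))

/-- The endomorphism obtained from `gramMatrix Q F` by raising an index with `Q`. -/
def gram (Q : Matrix n n R) (F : CubicTensor n R) : Matrix n n R :=
  Q * gramMatrix Q F

/-- The vector obtained by raising the index of `k ↦ tr (Q Fₖ N)`, where `N = gram Q F`. -/
def gramVector (Q : Matrix n n R) (F : CubicTensor n R) : n → R :=
  Q *ᵥ fun k => trace (Q * F k * gram Q F)

theorem gramMatrix_pull (Q γ : Matrix n n R) (F : CubicTensor n R) :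
    gramMatrix Q (pull γ F) = γᵀ * gramMatrix (γ * Q * γᵀ) F * γ := by
  have hcyc (a b : n) : trace (Q * (γᵀ * F a * γ) * (Q * (γᵀ * F b * γ))) =
      trace (γ * Q * γᵀ * F a * (γ * Q * γᵀ * F b)) := by
    rw [show γ * Q * γᵀ * F a * (γ * Q * γᵀ * F b) = γ * (Q * γᵀ * F a * γ * Q * γᵀ * F b) by
      simp only [Matrix.mul_assoc], trace_mul_comm γ]
    simp only [Matrix.mul_assoc]
  ext i j
  simp only [gramMatrix, of_apply, pull_apply, mul_smul_comm, smul_mul_assoc, trace_sum,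
    trace_smul, hcyc, Matrix.mul_apply (M := γᵀ * _),
    Matrix.mul_apply (M := γᵀ), transpose_apply, smul_eq_mul, Finset.sum_mul, Finset.mul_sum]
  exact Finset.sum_congr rfl fun a _ => Finset.sum_congr rfl fun b _ => by ring

theorem mul_gram_pull (Q γ : Matrix n n R) (F : CubicTensor n R) :
    γ * gram Q (pull γ F) = gram (γ * Q * γᵀ) F * γ := by
  simp only [gram, gramMatrix_pull, Matrix.mul_assoc]

theorem mulVec_gramVector_pull (Q γ : Matrix n n R) (F : CubicTensor n R) :
    γ *ᵥ gramVector Q (pull γ F) = gramVector (γ * Q * γᵀ) F := by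
  have hcyc (m : n) : trace (Q * (γᵀ * F m * γ) * gram Q (pull γ F)) =
      trace (γ * Q * γᵀ * F m * gram (γ * Q * γᵀ) F) := by
    rw [show Q * (γᵀ * F m * γ) * gram Q (pull γ F) = Q * γᵀ * F m * (γ * gram Q (pull γ F)) by
      simp only [Matrix.mul_assoc], mul_gram_pull, ← Matrix.mul_assoc, trace_mul_comm]
    simp only [Matrix.mul_assoc]
  have lower : (fun k => trace (Q * pull γ F k * gram Q (pull γ F))) =
      γᵀ *ᵥ fun m => trace (γ * Q * γᵀ * F m * gram (γ * Q * γᵀ) F) := by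
    ext k
    simp only [pull_apply γ F k, Matrix.mul_sum, Matrix.sum_mul, mul_smul_comm, smul_mul_assoc,
      trace_sum, trace_smul, hcyc, mulVec, dotProduct, transpose_apply, smul_eq_mul]
  rw [gramVector, lower, mulVec_mulVec, mulVec_mulVec, gramVector]

theorem gram_smul (l c : R) (Q : Matrix n n R) (F : CubicTensor n R) :
    gram (l • Q) (c • F) = (l ^ 3 * c ^ 2) • gram Q F := by
  have hB : gramMatrix (l • Q) (c • F) = (l ^ 2 * c ^ 2) • gramMatrix Q F := by
    ext i j
    simp only [gramMatrix, of_apply, Pi.smul_apply, smul_mul_assoc, mul_smul_comm, trace_smul,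
      Matrix.smul_apply, smul_eq_mul]
    ring
  rw [gram, gram, hB, smul_mul_smul_comm]
  ring_nf

theorem gramVector_smul (l c : R) (Q : Matrix n n R) (F : CubicTensor n R) :
    gramVector (l • Q) (c • F) = (l ^ 5 * c ^ 3) • gramVector Q F := by
  ext i
  simp only [gramVector, gram_smul, mulVec, dotProduct, Pi.smul_apply, smul_mul_assoc,
    mul_smul_comm, trace_smul, Matrix.smul_apply, smul_eq_mul, Finset.mul_sum]
  exact Finset.sum_congr rfl fun j _ => by ring

end Covariants

/-- The matrix with columns `L, N L, …, Nⁿ⁻¹ L`. -/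
def krylov {n : ℕ} {R : Type*} [CommRing R] (N : Matrix (Fin n) (Fin n) R) (L : Fin n → R) :
    Matrix (Fin n) (Fin n) R :=
  of fun i j => (N ^ (j : ℕ) *ᵥ L) i

theorem eq_smul_one_of_commute {n : ℕ} {R : Type*} [CommRing R] {γ N : Matrix (Fin n) (Fin n) R}
    {L : Fin n → R} {ρ : R} (hN : Commute γ N) (hL : γ *ᵥ L = ρ • L) (hK : IsUnit (krylov N L)) :
    γ = ρ • (1 : Matrix (Fin n) (Fin n) R) := by
  apply hK.mul_right_cancel
  rw [smul_mul_assoc, Matrix.one_mul]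
  ext i j
  calc (γ * krylov N L) i j = (γ *ᵥ (N ^ (j : ℕ) *ᵥ L)) i := rfl
    _ = (ρ • (N ^ (j : ℕ) *ᵥ L)) i := by
      rw [mulVec_mulVec, (hN.pow_right _).eq, ← mulVec_mulVec, hL, mulVec_smul]

/-- The function of a trilinear form whose nonvanishing forces the stabilizer of the form up to
scale, among the similitudes of `Q`, to consist of scalar matrices. -/
def invariant {n : ℕ} {R : Type*} [CommRing R] (Q : Matrix (Fin n) (Fin n) R)
    (F : CubicTensor (Fin n) R) : R :=
  trace (gram Q F) * (krylov (gram Q F) (gramVector Q F)).det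

theorem exists_eq_smul_one_of_pull_eq_smul {n : ℕ} {K : Type*} [Field K]
    {Q γ : Matrix (Fin n) (Fin n) K} {F : CubicTensor (Fin n) K} {l κ : K} (hγ : IsUnit γ)
    (hκ : κ ≠ 0) (hQ : γ * Q * γᵀ = l • Q) (hF : pull γ F = κ • F) (hinv : invariant Q F ≠ 0) :
    ∃ ρ : K, γ = ρ • (1 : Matrix (Fin n) (Fin n) K) := by
  have hN : κ ^ 2 • (γ * gram Q F) = l ^ 3 • (gram Q F * γ) := by
    have h := mul_gram_pull Q γ F
    have hQF := gram_smul l 1 Q F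
    have hκF := gram_smul 1 κ Q F
    rw [one_smul, one_pow, mul_one] at hQF
    rw [one_smul, one_pow, one_mul] at hκF
    rwa [hF, hQ, hκF, hQF, mul_smul_comm, smul_mul_assoc] at h
  have hL : κ ^ 3 • (γ *ᵥ gramVector Q F) = l ^ 5 • gramVector Q F := by
    have h := mulVec_gramVector_pull Q γ F
    have hQF := gramVector_smul l 1 Q F
    have hκF := gramVector_smul 1 κ Q F
    rw [one_smul, one_pow, mul_one] at hQF
    rw [one_smul, one_pow, one_mul] at hκF
    rwa [hF, hQ, hκF, hQF, mulVec_smul] at h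
  have hscale : κ ^ 2 = l ^ 3 := by
    have hdet : IsUnit γ.det := (isUnit_iff_isUnit_det γ).1 hγ
    have h := congrArg (fun M => trace (M * γ⁻¹)) hN
    simp only [smul_mul_assoc, trace_smul, smul_eq_mul] at h
    rw [mul_nonsing_inv_cancel_right _ _ hdet, trace_mul_comm,
      nonsing_inv_mul_cancel_left _ _ hdet] at h
    exact mul_right_cancel₀ (left_ne_zero_of_mul hinv) h
  refine ⟨l ^ 5 / κ ^ 3, eq_smul_one_of_commute (N := gram Q F) (L := gramVector Q F) ?_ ?_ ?_⟩
  · exact smul_right_injective _ (pow_ne_zero 2 hκ) (hN.trans (by rw [hscale]))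
  · rw [div_eq_inv_mul, mul_smul, ← hL, inv_smul_smul₀ (pow_ne_zero 3 hκ)]
  · exact (isUnit_iff_isUnit_det _).2 (isUnit_iff_ne_zero.2 (right_ne_zero_of_mul hinv))

/-- The coordinates on `V'` induced by `wedgeCoeffs`. -/
noncomputable def coeffs : V' →ₗ[ℝ] (Fin 7 → ℝ) := W.liftQ wedgeCoeffs W_le_ker_wedgeCoeffs

theorem coeffs_mkQ (ω : ⋀[ℝ]^2 V) : coeffs (W.mkQ ω) = wedgeCoeffs ω := rfl

/-- The elements of `V'` whose harmonic trilinear form has vanishing invariant. -/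
def degenerate : Set V' := {y | invariant J (tensor (coeffs y)) = 0}

theorem ne_zero_of_notMem_degenerate {y : V'} (hy : y ∉ degenerate) : y ≠ 0 := by
  rintro rfl
  apply hy
  have h := gram_smul 1 0 J (tensor (coeffs 0))
  simp only [one_smul, zero_smul, zero_pow two_ne_zero, mul_zero] at h
  rw [degenerate, Set.mem_ofPred_eq, invariant, map_zero, map_zero, h, trace_zero, zero_mul]

theorem map_eq_sq_smul_id {α : V →ₗ[ℝ] V} {a : ℝ} (ha : ∀ v, α v = a • v) :
    exteriorPower.map 2 α = a ^ 2 • LinearMap.id := by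
  apply linearMap_ext_wedge
  intro v w
  simp only [map_wedge, ha, wedge_smul_left, wedge_smul_right, smul_smul, LinearMap.smul_apply,
    LinearMap.id_apply, pow_two]

section

variable {α : V ≃ₗ[ℝ] V} (hα : W ≤ W.comap (exteriorPower.map 2 α.toLinearMap)) {y : V'}
  (hy : y ∉ degenerate) {c : ℝ} (hc : c ≠ 0) (hαy : W.mapQ W _ hα y = c • y)

include hy hc hαy

theorem exists_eq_smul_of_mapQ_eq_smul : ∃ a : ℝ, ∀ v, α v = a • v := by
  obtain ⟨γ, μ, hγ, hcongr⟩ := exists_congruence_of_le_comap hα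
  have hμ := congruence_scale_ne_zero hγ hcongr
  obtain ⟨l, hl, hJ⟩ := exists_mul_J_mul_transpose_eq_smul hγ hcongr
  obtain ⟨ω, rfl⟩ := W.mkQ_surjective y
  have hdet : γ.det ≠ 0 := ((isUnit_iff_isUnit_det γ).1 hγ).ne_zero
  have hpull : pull γ (tensor (wedgeCoeffs ω)) =
      ((γ.det * c)⁻¹ * (l * μ ^ 2)) • tensor (wedgeCoeffs ω) := by
    have hω : wedgeCoeffs (exteriorPower.map 2 α.toLinearMap ω) = c • wedgeCoeffs ω := by
      rw [← coeffs_mkQ, ← coeffs_mkQ, ← map_smul, ← hαy]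
      rfl
    rw [mul_smul, ← pull_tensor_wedgeCoeffs (α := α.toLinearMap) hl hJ hcongr, hω, map_smul,
      map_smul, ← mul_smul γ.det, inv_smul_smul₀ (mul_ne_zero hdet hc)]
  obtain ⟨ρ, rfl⟩ := exists_eq_smul_one_of_pull_eq_smul hγ (by positivity) hJ hpull hy
  have hρ : ρ ≠ 0 := by
    rintro rfl
    simp at hdet
  refine ⟨μ / ρ ^ 2, fun v => Subtype.ext ?_⟩
  have hv := hcongr v
  simp only [transpose_smul, transpose_one, smul_mul_assoc, Matrix.one_mul, mul_smul_comm,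
    Matrix.mul_one, smul_smul, ← pow_two] at hv
  rw [Submodule.coe_smul, div_eq_inv_mul, mul_smul, ← hv, inv_smul_smul₀ (pow_ne_zero 2 hρ)]

theorem exists_sq_eq_of_mapQ_eq_smul : ∃ a : ℝ, a ^ 2 = c ∧ ∀ v, α v = a • v := by
  obtain ⟨a, ha⟩ := exists_eq_smul_of_mapQ_eq_smul hα hy hc hαy
  refine ⟨a, smul_left_injective ℝ (ne_zero_of_notMem_degenerate hy) ?_, ha⟩
  simp only [← hαy]
  obtain ⟨ω, rfl⟩ := W.mkQ_surjective y
  rw [Submodule.mkQ_apply, Submodule.mapQ_apply, map_eq_sq_smul_id (α := α.toLinearMap) ha]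
  rfl

end

end Rigidity

section NullSet

open MeasureTheory

theorem ae_ne_zero_of_analyticOnNhd {f : ℝ → ℝ} (hf : AnalyticOnNhd ℝ f Set.univ)
    {t₀ : ℝ} (ht₀ : f t₀ ≠ 0) : ∀ᵐ t, f t ≠ 0 := by
  have hae := ae_restrict_le_codiscreteWithin (μ := (volume : Measure ℝ)) MeasurableSet.univ
  rw [Measure.restrict_univ] at hae
  exact hae (hf.preimage_zero_mem_codiscrete ht₀)

theorem volume_zeros_eq_zero {n : ℕ} {f : (Fin n → ℝ) → ℝ} (hf : AnalyticOnNhd ℝ f Set.univ)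
    (hne : ∃ x, f x ≠ 0) : volume {x | f x = 0} = 0 := by
  induction n with
  | zero =>
    obtain ⟨x₀, hx₀⟩ := hne
    have hempty : {x | f x = 0} = ∅ :=
      Set.eq_empty_of_forall_notMem fun x hx => hx₀ (Subsingleton.elim x x₀ ▸ hx)
    rw [hempty, measure_empty]
  | succ n ih =>
    have hmeas : MeasurableSet {x | f x = 0} :=
      (isClosed_eq (continuousOn_univ.1 hf.continuousOn) continuous_const).measurableSet
    let e := MeasurableEquiv.piFinSuccAbove (fun _ : Fin (n + 1) => ℝ) 0
    have he : MeasurePreserving e.symm :=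
      (volume_preserving_piFinSuccAbove (fun _ : Fin (n + 1) => ℝ) 0).symm
    rw [← he.measure_preimage hmeas.nullMeasurableSet, Measure.volume_eq_prod,
      Measure.measure_prod_null (he.measurable hmeas)]
    have hslice (p : ℝ × (Fin n → ℝ)) : e.symm p = Fin.cons p.1 p.2 := by
      ext i
      refine Fin.cases ?_ (fun j => ?_) i <;> simp [e]
    have hcons (p : ℝ × (Fin n → ℝ)) : AnalyticAt ℝ (fun q => f (Fin.cons q.1 q.2)) p :=
      (hf _ trivial).fun_comp ((Fin.consEquivL ℝ fun _ => ℝ).analyticAt p)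
    obtain ⟨x₀, hx₀⟩ := hne
    have hline : AnalyticOnNhd ℝ (fun t => f (Fin.cons t (Fin.tail x₀))) Set.univ :=
      fun t _ => (hcons (t, Fin.tail x₀)).along_fst
    rw [← Fin.cons_self_tail x₀] at hx₀
    filter_upwards [ae_ne_zero_of_analyticOnNhd hline hx₀] with t ht
    have hzeros : Prod.mk t ⁻¹' (e.symm ⁻¹' {x | f x = 0}) = {y | f (Fin.cons t y) = 0} :=
      Set.ext fun y => by simp only [Set.mem_preimage, Set.mem_ofPred_eq, hslice]
    rw [hzeros]
    exact ih (fun y _ => (hcons (t, y)).along_snd) ⟨Fin.tail x₀, ht⟩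

section Analytic

variable {E m n p : Type*} [NormedAddCommGroup E] [NormedSpace ℝ E]

/-- The family of matrices `M` depends analytically on its parameter, entry by entry. -/
def AnalyticEntries (M : E → Matrix m n ℝ) : Prop :=
  ∀ i j x, AnalyticAt ℝ (fun x => M x i j) x

theorem AnalyticEntries.const (M : Matrix m n ℝ) : AnalyticEntries fun _ : E => M :=
  fun _ _ _ => analyticAt_const

theorem AnalyticEntries.mul [Fintype n] {M : E → Matrix m n ℝ} {N : E → Matrix n p ℝ}
    (hM : AnalyticEntries M) (hN : AnalyticEntries N) : AnalyticEntries fun x => M x * N x := by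
  intro i j x
  simp only [Matrix.mul_apply]
  exact Finset.univ.analyticAt_fun_sum fun k _ => (hM i k x).mul (hN k j x)

theorem AnalyticEntries.pow [Fintype n] [DecidableEq n] {M : E → Matrix n n ℝ}
    (hM : AnalyticEntries M) (k : ℕ) : AnalyticEntries fun x => M x ^ k := by
  induction k with
  | zero => simpa only [pow_zero] using AnalyticEntries.const 1
  | succ k ih => simpa only [pow_succ] using ih.mul hM

theorem AnalyticEntries.trace [Fintype n] {M : E → Matrix n n ℝ} (hM : AnalyticEntries M)
    (x : E) : AnalyticAt ℝ (fun x => (M x).trace) x :=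
  Finset.univ.analyticAt_fun_sum fun k _ => hM k k x

theorem AnalyticEntries.det [Fintype n] [DecidableEq n] {M : E → Matrix n n ℝ}
    (hM : AnalyticEntries M) (x : E) : AnalyticAt ℝ (fun x => (M x).det) x := by
  simp only [det_apply']
  exact Finset.univ.analyticAt_fun_sum fun s _ =>
    analyticAt_const.mul (Finset.univ.analyticAt_fun_prod fun i _ => hM (s i) i x)

theorem AnalyticEntries.mulVec [Fintype n] {M : E → Matrix m n ℝ} (hM : AnalyticEntries M)
    {v : E → n → ℝ} (hv : ∀ i x, AnalyticAt ℝ (fun x => v x i) x) (i : m) (x : E) :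
    AnalyticAt ℝ (fun x => (M x *ᵥ v x) i) x :=
  Finset.univ.analyticAt_fun_sum fun k _ => (hM i k x).mul (hv k x)

theorem analyticAt_invariant {n : ℕ} (Q : Matrix (Fin n) (Fin n) ℝ)
    {F : E → CubicTensor (Fin n) ℝ} (hF : ∀ k, AnalyticEntries fun x => F x k) (x : E) :
    AnalyticAt ℝ (fun x => invariant Q (F x)) x := by
  have hQF (k : Fin n) : AnalyticEntries fun x => Q * F x k := (AnalyticEntries.const Q).mul (hF k)
  have hN : AnalyticEntries fun x => gram Q (F x) :=
    (AnalyticEntries.const Q).mul fun i j x => ((hQF i).mul (hQF j)).trace x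
  have hL : ∀ i x, AnalyticAt ℝ (fun x => gramVector Q (F x) i) x :=
    (AnalyticEntries.const Q).mulVec fun i x => ((hQF i).mul hN).trace x
  have hK : AnalyticEntries fun x => krylov (gram Q (F x)) (gramVector Q (F x)) :=
    fun i j x => (hN.pow j).mulVec hL i x
  exact (hN.trace x).mul (hK.det x)

end Analytic

theorem exists_notMem_degenerate : ∃ y, y ∉ degenerate := by
  refine ⟨W.mkQ (wedge σ₁ σ₃ + wedge σ₃ σ₅ + wedge σ₄ σ₅), ?_⟩
  have hcoeffs :
      coeffs (W.mkQ (wedge σ₁ σ₃ + wedge σ₃ σ₅ + wedge σ₄ σ₅)) = ![0, 1, 0, 0, 0, 1, 1] := by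
    rw [coeffs_mkQ, map_add, map_add, wedgeCoeffs_wedge, wedgeCoeffs_wedge, wedgeCoeffs_wedge]
    ext i
    fin_cases i <;> simp [σ₁, σ₃, σ₄, σ₅]
  have htensor : tensor ![0, 1, 0, 0, 0, 1, 1] =
      ![!![0, 5, 0; 5, 0, 0; 0, 0, 0], !![5, 0, 0; 0, 0, 0; 0, 0, 5],
        !![0, 0, 0; 0, 0, 5; 0, 5, 5]] := by
    ext k i j
    fin_cases k <;> fin_cases i <;> fin_cases j <;> simp [tensor]
  have hgram : gram J (tensor ![0, 1, 0, 0, 0, 1, 1]) = !![50, -25, 0; 0, 50, 25; 0, 0, 50] := by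
    rw [htensor]
    ext i j
    fin_cases i <;> fin_cases j <;>
      simp [gram, gramMatrix, J, Matrix.mul_apply, trace, Fin.sum_univ_three] <;> norm_num
  have hvector : gramVector J (tensor ![0, 1, 0, 0, 0, 1, 1]) = ![0, 0, 250] := by
    rw [gramVector, hgram, htensor]
    ext i
    fin_cases i <;> simp [J, mulVec, dotProduct, trace, Fin.sum_univ_three]
    norm_num
  have hkrylov : krylov !![50, -25, 0; 0, 50, 25; 0, 0, 50] ![0, 0, 250] =
      !![0, 0, -156250; 0, 6250, 625000; 250, 12500, (625000 : ℝ)] := by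
    ext i j
    fin_cases i <;> fin_cases j <;>
      simp [krylov, pow_two, mulVec, dotProduct, Matrix.mul_apply, Fin.sum_univ_three] <;> norm_num
  change invariant J _ ≠ 0
  rw [hcoeffs, invariant, hgram, hvector, hkrylov, det_fin_three]
  simp only [trace_fin_three, of_apply, cons_val]
  norm_num

theorem volume_degenerate :
    volume ((Module.finBasis ℝ V').equivFun '' degenerate) = 0 := by
  let e := (Module.finBasis ℝ V').equivFun
  have himage : e '' degenerate = {x | invariant J (tensor (coeffs (e.symm x))) = 0} :=
    LinearEquiv.image_eq_preimage_symm e degenerate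
  rw [himage]
  obtain ⟨y, hy⟩ := exists_notMem_degenerate
  refine volume_zeros_eq_zero (fun x _ => analyticAt_invariant J (fun k i j x => ?_) x)
    ⟨e y, by rwa [e.symm_apply_apply]⟩
  let entry : (Fin (Module.finrank ℝ V') → ℝ) →ₗ[ℝ] ℝ :=
    entryLinearMap ℝ ℝ i j ∘ₗ LinearMap.proj k ∘ₗ tensor ∘ₗ coeffs ∘ₗ e.symm.toLinearMap
  exact entry.toContinuousLinearMap.analyticAt x

end NullSet

section Topology

noncomputable instance : TopologicalSpace NilAlg := moduleTopology ℝ NilAlg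

instance : IsModuleTopology ℝ NilAlg := ⟨rfl⟩

instance : IsTopologicalAddGroup NilAlg := IsModuleTopology.topologicalAddGroup ℝ NilAlg

instance : ContinuousSMul ℝ NilAlg := IsModuleTopology.toContinuousSMul ℝ NilAlg

theorem continuous_log : Continuous NilGroup.log := NilGroup.logHomeomorph.continuous

theorem continuous_exp : Continuous NilGroup.exp := NilGroup.logHomeomorph.symm.continuous

theorem continuous_log_fst : Continuous fun g : NilGroup => g.log.1 :=
  (IsModuleTopology.continuous_of_linearMap
    (show NilAlg →ₗ[ℝ] V from LinearMap.fst ℝ V V')).comp continuous_log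

theorem continuous_exp_inl : Continuous fun v : V => NilGroup.exp (v, 0) :=
  continuous_exp.comp
    (show V →ₗ[ℝ] NilAlg from LinearMap.inl ℝ V V').continuous_of_finiteDimensional

end Topology

section Quotient

open scoped commutatorElement

theorem map_mem_commutator {G H : Type*} [Group G] [Group H] (f : G →* H) {g : G}
    (hg : g ∈ commutator G) : f g ∈ commutator H :=
  (Subgroup.map_commutator ⊤ ⊤ f).le.trans (Subgroup.commutator_mono le_top le_top)
    (Subgroup.mem_map_of_mem f hg)

variable {θ : commutator NilGroup}

/-- The projection of `G' = G / ⟨θ⟩` to `V`, as a group homomorphism. -/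
noncomputable def projHom (θ : commutator NilGroup) : Quo θ →* Multiplicative V :=
  QuotientGroup.lift _ NilGroup.toV <| Subgroup.zpowers_le.2 <|
    congrArg Multiplicative.ofAdd ((NilGroup.mem_commutator_iff _).1 θ.2)

/-- The projection of `G' = G / ⟨θ⟩` to `V`, which identifies `G' / [G', G']` with `V`. -/
noncomputable def proj (g : Quo θ) : V := (projHom θ g).toAdd

theorem proj_mul (g h : Quo θ) : proj (g * h) = proj g + proj h := by
  rw [proj, map_mul, toAdd_mul, proj, proj]

theorem proj_inv (g : Quo θ) : proj g⁻¹ = -proj g := by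
  rw [proj, map_inv, toAdd_inv, proj]

theorem continuous_proj : Continuous (proj : Quo θ → V) :=
  continuous_quot_lift _ continuous_log_fst

/-- The section `v ↦ exp v` of `proj`. -/
noncomputable def expV (θ : commutator NilGroup) (v : V) : Quo θ :=
  QuotientGroup.mk (NilGroup.exp (v, 0))

theorem proj_expV (v : V) : proj (expV θ v) = v := rfl

theorem continuous_expV : Continuous (expV θ) := continuous_quot_mk.comp continuous_exp_inl

/-- The exponential map of the centre `V'` of the Lie algebra into `G`, as a group
homomorphism. -/
noncomputable def centralHom : Multiplicative V' →* NilGroup where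
  toFun y := NilGroup.exp (0, y.toAdd)
  map_one' := rfl
  map_mul' y z := by
    ext1
    rw [NilGroup.log_mul]
    apply NilAlg.ext
    · change (0 : V) = 0 + 0 + (1 / 2 : ℝ) • (0 : V)
      rw [smul_zero, add_zero, add_zero]
    · change y.toAdd + z.toAdd = y.toAdd + z.toAdd + (1 / 2 : ℝ) • wedgeMod 0 0
      rw [map_zero, smul_zero, add_zero]

/-- The exponential map of the centre `V'` of the Lie algebra into `G' = G / ⟨θ⟩`. -/
noncomputable def central (θ : commutator NilGroup) (y : V') : Quo θ :=
  QuotientGroup.mk (centralHom (Multiplicative.ofAdd y))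

theorem central_zero : central θ 0 = 1 := rfl

theorem central_add (y z : V') : central θ (y + z) = central θ y * central θ z := by
  rw [central, ofAdd_add, map_mul]
  rfl

theorem centralHom_log_snd {g : NilGroup} (hg : g.log.1 = 0) :
    centralHom (Multiplicative.ofAdd g.log.2) = g :=
  NilGroup.ext (NilAlg.ext hg.symm rfl)

theorem central_eq_one_iff {y : V'} :
    central θ y = 1 ↔ ∃ n : ℤ, y = n • (θ : NilGroup).log.2 := by
  have hinj : Function.Injective centralHom := fun y z h =>
    congrArg (fun g : NilGroup => g.log.2) h
  rw [central, QuotientGroup.eq_one_iff, Subgroup.mem_zpowers_iff]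
  refine exists_congr fun n => ?_
  rw [← centralHom_log_snd ((NilGroup.mem_commutator_iff _).1 θ.2), ← map_zpow, ← ofAdd_zsmul,
    hinj.eq_iff]
  exact eq_comm

theorem exists_central_eq {g : Quo θ} (hg : proj g = 0) : ∃ y, central θ y = g := by
  induction g using QuotientGroup.induction_on with
  | H g => exact ⟨g.log.2, congrArg QuotientGroup.mk (centralHom_log_snd hg)⟩

theorem commutatorElement_eq_central (g h : Quo θ) :
    ⁅g, h⁆ = central θ (W.mkQ (wedge (proj g) (proj h))) := by
  induction g using QuotientGroup.induction_on with
  | H g =>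
    induction h using QuotientGroup.induction_on with
    | H h => exact congrArg QuotientGroup.mk (NilGroup.ext (NilGroup.log_commutator g h))

theorem mem_commutator_iff_proj_eq_zero {g : Quo θ} : g ∈ commutator (Quo θ) ↔ proj g = 0 := by
  refine ⟨fun hg => Abelianization.commutator_subset_ker (projHom θ) hg, fun hg => ?_⟩
  induction g using QuotientGroup.induction_on with
  | H g => exact map_mem_commutator (QuotientGroup.mk' _) ((NilGroup.mem_commutator_iff g).2 hg)

theorem isClosed_commutator (θ : commutator NilGroup) :
    IsClosed (commutator (Quo θ) : Set (Quo θ)) := by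
  have hpreimage : (commutator (Quo θ) : Set (Quo θ)) = proj ⁻¹' {0} :=
    Set.ext fun _ => mem_commutator_iff_proj_eq_zero
  rw [hpreimage]
  exact isClosed_singleton.preimage continuous_proj

theorem inv_mul_mem_commutator_iff {g h : Quo θ} :
    g⁻¹ * h ∈ commutator (Quo θ) ↔ proj h = proj g := by
  rw [mem_commutator_iff_proj_eq_zero, proj_mul, proj_inv, neg_add_eq_zero, eq_comm]

theorem mem_smul_commutator_iff {g h : Quo θ} :
    h ∈ g • (commutator (Quo θ) : Set (Quo θ)) ↔ proj h = proj g := by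
  rw [mem_leftCoset_iff, SetLike.mem_coe, inv_mul_mem_commutator_iff]

theorem smul_commutator_ne_inv_smul {g : Quo θ} (hg : g ∉ commutator (Quo θ)) :
    g • (commutator (Quo θ) : Set (Quo θ)) ≠ g⁻¹ • (commutator (Quo θ) : Set (Quo θ)) := by
  intro h
  have hself : g ∈ g • (commutator (Quo θ) : Set (Quo θ)) := mem_smul_commutator_iff.2 rfl
  rw [h, mem_smul_commutator_iff, proj_inv] at hself
  have htwo : (2 : ℝ) • proj g = 0 := by linear_combination (norm := module) hself
  exact hg (mem_commutator_iff_proj_eq_zero.2 ((smul_eq_zero_iff_right two_ne_zero).1 htwo))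

end Quotient

section LinearPart

open scoped commutatorElement

variable {θ₁ θ₂ θ₃ : commutator NilGroup}

theorem proj_map_eq_of_proj_eq (φ : Quo θ₁ →ₜ* Quo θ₂) {g h : Quo θ₁} (hgh : proj g = proj h) :
    proj (φ g) = proj (φ h) := by
  rw [← inv_mul_mem_commutator_iff] at hgh ⊢
  rw [← map_inv, ← map_mul]
  exact map_mem_commutator φ.toMonoidHom hgh

/-- The linear endomorphism of `V` induced by a continuous homomorphism between quotients of `G`;
linearity over `ℝ` comes from continuity. -/
noncomputable def linearPart (φ : Quo θ₁ →ₜ* Quo θ₂) : V →ₗ[ℝ] V :=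
  (AddMonoidHom.mk' (fun v => proj (φ (expV θ₁ v))) fun v w => by
    rw [← proj_mul, ← map_mul]
    exact proj_map_eq_of_proj_eq φ (proj_mul (expV θ₁ v) (expV θ₁ w)).symm).toRealLinearMap
      (continuous_proj.comp (φ.continuous.comp continuous_expV))

theorem proj_map (φ : Quo θ₁ →ₜ* Quo θ₂) (g : Quo θ₁) : proj (φ g) = linearPart φ (proj g) :=
  proj_map_eq_of_proj_eq φ (proj_expV _).symm

theorem linearPart_id : linearPart (ContinuousMonoidHom.id (Quo θ₁)) = LinearMap.id := rfl

theorem linearPart_comp (ψ : Quo θ₂ →ₜ* Quo θ₃) (φ : Quo θ₁ →ₜ* Quo θ₂) :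
    linearPart (ψ.comp φ) = linearPart ψ ∘ₗ linearPart φ :=
  LinearMap.ext fun v => proj_map ψ (φ (expV θ₁ v))

theorem map_central_mkQ (φ : Quo θ₁ →ₜ* Quo θ₂) (ω : ⋀[ℝ]^2 V) :
    φ (central θ₁ (W.mkQ ω)) = central θ₂ (W.mkQ (exteriorPower.map 2 (linearPart φ) ω)) := by
  induction ω using wedge_induction with
  | zero => simp only [map_zero, central_zero, map_one]
  | add ω η hω hη => simp only [map_add, central_add, map_mul, hω, hη]
  | wedge v w =>
    calc φ (central θ₁ (W.mkQ (wedge v w))) = φ ⁅expV θ₁ v, expV θ₁ w⁆ := by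
          rw [commutatorElement_eq_central, proj_expV, proj_expV]
      _ = central θ₂ (W.mkQ (exteriorPower.map 2 (linearPart φ) (wedge v w))) := by
          rw [map_commutatorElement, commutatorElement_eq_central, proj_map, proj_map, proj_expV,
            proj_expV, map_wedge]

theorem eq_zero_of_forall_smul_mem_zmultiples {E : Type*} [AddCommGroup E] [Module ℝ E] {y z : E}
    (h : ∀ t : ℝ, ∃ n : ℤ, t • y = n • z) : y = 0 := by
  by_contra hy
  choose n hn using h
  have hinj : Function.Injective n := fun s t hst =>
    smul_left_injective ℝ hy (by simp only [hn, hst])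
  exact not_countable hinj.countable

theorem W_le_comap_linearPart (φ : Quo θ₁ →ₜ* Quo θ₂) :
    W ≤ W.comap (exteriorPower.map 2 (linearPart φ)) := by
  intro ω hω
  rw [Submodule.mem_comap, ← W.ker_mkQ, LinearMap.mem_ker]
  refine eq_zero_of_forall_smul_mem_zmultiples fun t => central_eq_one_iff (θ := θ₂).1 ?_
  have htω : W.mkQ (t • ω) = 0 := (Submodule.Quotient.mk_eq_zero W).2 (W.smul_mem t hω)
  rw [← map_smul, ← map_smul, ← map_central_mkQ, htω, central_zero, map_one]

/-- The linear endomorphism of `V'` induced by a continuous homomorphism between quotients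
of `G`. -/
noncomputable def centralPart (φ : Quo θ₁ →ₜ* Quo θ₂) : V' →ₗ[ℝ] V' :=
  W.mapQ W (exteriorPower.map 2 (linearPart φ)) (W_le_comap_linearPart φ)

theorem map_central (φ : Quo θ₁ →ₜ* Quo θ₂) (y : V') :
    φ (central θ₁ y) = central θ₂ (centralPart φ y) := by
  obtain ⟨ω, rfl⟩ := W.mkQ_surjective y
  exact map_central_mkQ φ ω

theorem exists_centralPart_log_eq_zsmul (φ : Quo θ₁ →ₜ* Quo θ₂) :
    ∃ n : ℤ, centralPart φ (θ₁ : NilGroup).log.2 = n • (θ₂ : NilGroup).log.2 := by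
  rw [← central_eq_one_iff, ← map_central, central_eq_one_iff.2 ⟨1, (one_smul ℤ _).symm⟩, map_one]

end LinearPart

section Automorphism

variable {θ : commutator NilGroup}

theorem linearPart_comp_linearPart_eq_id {φ ψ : Quo θ →ₜ* Quo θ}
    (h : ψ.comp φ = ContinuousMonoidHom.id (Quo θ)) : linearPart ψ ∘ₗ linearPart φ = .id := by
  rw [← linearPart_comp, h, linearPart_id]

theorem centralPart_centralPart {φ ψ : Quo θ →ₜ* Quo θ}
    (h : ψ.comp φ = ContinuousMonoidHom.id (Quo θ)) (y : V') :
    centralPart ψ (centralPart φ y) = y := by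
  obtain ⟨ω, rfl⟩ := W.mkQ_surjective y
  change W.mkQ ((exteriorPower.map 2 (linearPart ψ) ∘ₗ exteriorPower.map 2 (linearPart φ)) ω) = _
  rw [← exteriorPower.map_comp, linearPart_comp_linearPart_eq_id h, exteriorPower.map_id]
  rfl

theorem exists_centralPart_log_eq_zsmul_of_mul_eq_one (hθ : (θ : NilGroup).log.2 ∉ degenerate)
    {φ ψ : Quo θ →ₜ* Quo θ} (h : ψ.comp φ = ContinuousMonoidHom.id (Quo θ)) :
    ∃ n m : ℤ, m * n = 1 ∧ centralPart φ (θ : NilGroup).log.2 = n • (θ : NilGroup).log.2 := by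
  obtain ⟨n, hn⟩ := exists_centralPart_log_eq_zsmul φ
  obtain ⟨m, hm⟩ := exists_centralPart_log_eq_zsmul ψ
  refine ⟨n, m, ?_, hn⟩
  have hmn := centralPart_centralPart h (θ : NilGroup).log.2
  rw [hn, map_zsmul, hm, ← mul_smul, ← Int.cast_smul_eq_zsmul ℝ] at hmn
  have hcast : ((n * m : ℤ) : ℝ) = 1 :=
    smul_left_injective ℝ (ne_zero_of_notMem_degenerate hθ) (hmn.trans (one_smul ℝ _).symm)
  rw [mul_comm]
  exact_mod_cast hcast

theorem exists_linearPart_eq_smul_of_comp_eq_id (hθ : (θ : NilGroup).log.2 ∉ degenerate)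
    {φ ψ : Quo θ →ₜ* Quo θ} (hφψ : φ.comp ψ = ContinuousMonoidHom.id (Quo θ))
    (hψφ : ψ.comp φ = ContinuousMonoidHom.id (Quo θ)) :
    ∃ a : ℝ, a ^ 2 = 1 ∧ ∀ v, linearPart φ v = a • v := by
  obtain ⟨n, m, hmn, hn⟩ := exists_centralPart_log_eq_zsmul_of_mul_eq_one hθ hψφ
  have hn0 : (n : ℝ) ≠ 0 := Int.cast_ne_zero.2 (right_ne_zero_of_mul_eq_one hmn)
  let α : V ≃ₗ[ℝ] V := .ofLinearMap (linearPart φ) (linearPart ψ)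
    (linearPart_comp_linearPart_eq_id hφψ) (linearPart_comp_linearPart_eq_id hψφ)
  obtain ⟨a, ha, hα⟩ := exists_sq_eq_of_mapQ_eq_smul (α := α) (W_le_comap_linearPart φ) hθ hn0
    (hn.trans (Int.cast_smul_eq_zsmul ℝ n _).symm)
  have hnonneg : 0 ≤ n := by exact_mod_cast ha ▸ sq_nonneg a
  have hn1 : n = 1 := Int.eq_one_of_mul_eq_one_left hnonneg hmn
  exact ⟨a, by rw [ha, hn1, Int.cast_one], hα⟩

theorem exists_linearPart_eq_smul (hθ : (θ : NilGroup).log.2 ∉ degenerate) (τ : Quo θ ≃ₜ* Quo θ) :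
    ∃ a : ℝ, a ^ 2 = 1 ∧ ∀ v, linearPart (τ : Quo θ →ₜ* Quo θ) v = a • v :=
  exists_linearPart_eq_smul_of_comp_eq_id hθ (ψ := (τ.symm : Quo θ →ₜ* Quo θ))
    (ContinuousMonoidHom.ext τ.apply_symm_apply) (ContinuousMonoidHom.ext τ.symm_apply_apply)

theorem proj_map_eq_or_inv (hθ : (θ : NilGroup).log.2 ∉ degenerate) (τ : Quo θ ≃ₜ* Quo θ) :
    (∀ g, proj (τ g) = proj g) ∨ ∀ g, proj (τ g) = proj g⁻¹ := by
  obtain ⟨a, ha, hτ⟩ := exists_linearPart_eq_smul hθ τ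
  have hproj (g : Quo θ) : proj (τ g) = a • proj g := (proj_map _ g).trans (hτ _)
  rcases sq_eq_one_iff.1 ha with rfl | rfl
  · exact Or.inl fun g => by rw [hproj, one_smul]
  · exact Or.inr fun g => by rw [hproj, proj_inv]; module

theorem factor_eq_self_or_inv (hθ : (θ : NilGroup).log.2 ∉ degenerate) (τ : Quo θ ≃ₜ* Quo θ) :
    (∀ x, factor τ x = x) ∨ ∀ x, factor τ x = x⁻¹ := by
  refine (proj_map_eq_or_inv hθ τ).imp (fun h x => ?_) fun h x => ?_ <;>
    induction x using QuotientGroup.induction_on with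
    | H g => exact QuotientGroup.eq.2 (inv_mul_mem_commutator_iff.2 (h g).symm)

theorem map_eq_self_of_mem_commutator (hθ : (θ : NilGroup).log.2 ∉ degenerate)
    (τ : Quo θ ≃ₜ* Quo θ) {g : Quo θ} (hg : g ∈ commutator (Quo θ)) : τ g = g := by
  obtain ⟨a, ha, hτ⟩ := exists_linearPart_eq_smul hθ τ
  obtain ⟨y, rfl⟩ := exists_central_eq (mem_commutator_iff_proj_eq_zero.1 hg)
  obtain ⟨ω, rfl⟩ := W.mkQ_surjective y
  have hmap := map_central_mkQ (τ : Quo θ →ₜ* Quo θ) ω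
  rwa [map_eq_sq_smul_id hτ, ha, one_smul] at hmap

theorem autOrbit_eq_singleton (hθ : (θ : NilGroup).log.2 ∉ degenerate) {g : Quo θ}
    (hg : g ∈ commutator (Quo θ)) : autOrbit g = {g} :=
  Set.eq_singleton_iff_unique_mem.2 ⟨⟨ContinuousMulEquiv.refl _, rfl⟩,
    Set.forall_mem_range.2 fun τ => map_eq_self_of_mem_commutator hθ τ hg⟩

end Automorphism

section Shear

/-- The automorphism of `G` with differential `f`. -/
noncomputable def integrate (f : NilAlg ≃ₗ⁅ℝ⁆ NilAlg) : NilGroup ≃ₜ* NilGroup where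
  toFun g := NilGroup.exp (f g.log)
  invFun g := NilGroup.exp (f.symm g.log)
  left_inv g := congrArg NilGroup.exp (f.symm_apply_apply g.log)
  right_inv g := congrArg NilGroup.exp (f.apply_symm_apply g.log)
  map_mul' g h := by
    ext1
    simp only [NilGroup.log_mul, map_add, map_smul, LieEquiv.map_lie]
  continuous_toFun := continuous_exp.comp <|
    (IsModuleTopology.continuous_of_linearMap f.toLinearEquiv.toLinearMap).comp continuous_log
  continuous_invFun := continuous_exp.comp <|
    (IsModuleTopology.continuous_of_linearMap f.symm.toLinearEquiv.toLinearMap).comp continuous_log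

/-- The automorphism `(v, y) ↦ (ε v, y + β v)` of the Lie algebra of `G`, where `ε = ±1`. -/
noncomputable def shear (ε : ℤˣ) (β : V →ₗ[ℝ] V') : NilAlg ≃ₗ⁅ℝ⁆ NilAlg where
  toFun x := ((ε : ℤ) • x.1, x.2 + β x.1)
  invFun x := ((ε : ℤ) • x.1, x.2 - β ((ε : ℤ) • x.1))
  map_add' x y := NilAlg.ext (smul_add _ _ _) <| by
    change x.2 + y.2 + β (x.1 + y.1) = x.2 + β x.1 + (y.2 + β y.1)
    rw [map_add, add_add_add_comm]
  map_smul' c x := NilAlg.ext (smul_comm _ _ _) <| by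
    change c • x.2 + β (c • x.1) = c • (x.2 + β x.1)
    rw [map_smul, smul_add]
  map_lie' {x y} := NilAlg.ext (smul_zero _) <| by
    change wedgeMod x.1 y.1 + β 0 = wedgeMod ((ε : ℤ) • x.1) ((ε : ℤ) • y.1)
    rw [map_zero, add_zero, map_zsmul, map_zsmul, LinearMap.smul_apply, smul_smul,
      Int.units_coe_mul_self, one_smul]
  left_inv x := NilAlg.ext (by simp only [smul_smul, Int.units_coe_mul_self, one_smul])
    (by simp only [smul_smul, Int.units_coe_mul_self, one_smul, add_sub_cancel_right])
  right_inv x := NilAlg.ext (by simp only [smul_smul, Int.units_coe_mul_self, one_smul])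
    (sub_add_cancel _ _)

variable {θ : commutator NilGroup}

theorem shear_log (ε : ℤˣ) (β : V →ₗ[ℝ] V') {g : NilGroup} (hg : g.log.1 = 0) :
    shear ε β g.log = g.log := by
  apply NilAlg.ext
  · change (ε : ℤ) • g.log.1 = g.log.1
    rw [hg, smul_zero]
  · change g.log.2 + β g.log.1 = g.log.2
    rw [hg, map_zero, add_zero]

/-- The automorphism of `G' = G / ⟨θ⟩` induced by an automorphism of `G` that fixes `θ`. -/
noncomputable def quoCongr (f : NilGroup ≃ₜ* NilGroup) (hf : f θ = θ) : Quo θ ≃ₜ* Quo θ where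
  toMulEquiv := QuotientGroup.congr _ _ f.toMulEquiv <|
    (MonoidHom.map_zpowers _ _).trans (congrArg Subgroup.zpowers hf)
  continuous_toFun := continuous_quot_lift _ (continuous_quot_mk.comp f.continuous)
  continuous_invFun := continuous_quot_lift _ (continuous_quot_mk.comp f.symm.continuous)

theorem exists_linearMap_apply_eq {E F : Type*} [AddCommGroup E] [Module ℝ E] [AddCommGroup F]
    [Module ℝ F] {v : E} (hv : v ≠ 0) (w : F) : ∃ β : E →ₗ[ℝ] F, β v = w := by
  obtain ⟨φ, hφ⟩ := Module.Projective.exists_dual_eq_one ℝ hv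
  exact ⟨φ.smulRight w, by rw [LinearMap.smulRight_apply, hφ, one_smul]⟩

theorem mem_autOrbit_of_proj_eq_smul (ε : ℤˣ) {g h : Quo θ} (hg : g ∉ commutator (Quo θ))
    (hgh : proj h = (ε : ℤ) • proj g) : h ∈ autOrbit g := by
  rw [mem_commutator_iff_proj_eq_zero] at hg
  induction g using QuotientGroup.induction_on with
  | H g =>
    induction h using QuotientGroup.induction_on with
    | H h =>
      obtain ⟨β, hβ⟩ := exists_linearMap_apply_eq hg (h.log.2 - g.log.2)
      have hθ : integrate (shear ε β) θ = θ :=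
        congrArg NilGroup.exp (shear_log ε β ((NilGroup.mem_commutator_iff _).1 θ.2))
      refine ⟨quoCongr (integrate (shear ε β)) hθ, congrArg QuotientGroup.mk ?_⟩
      refine NilGroup.ext (NilAlg.ext hgh.symm ?_)
      exact (congrArg (g.log.2 + ·) hβ).trans (add_sub_cancel _ _)

theorem autOrbit_eq_union (hθ : (θ : NilGroup).log.2 ∉ degenerate) {g : Quo θ}
    (hg : g ∉ commutator (Quo θ)) :
    autOrbit g = g • (commutator (Quo θ) : Set (Quo θ)) ∪
      g⁻¹ • (commutator (Quo θ) : Set (Quo θ)) := by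
  ext h
  rw [Set.mem_union, mem_smul_commutator_iff, mem_smul_commutator_iff]
  constructor
  · rintro ⟨τ, rfl⟩
    exact (proj_map_eq_or_inv hθ τ).imp (fun hτ => hτ g) fun hτ => hτ g
  · rintro (hgh | hgh)
    · refine mem_autOrbit_of_proj_eq_smul 1 hg ?_
      rw [hgh, Units.val_one, one_smul]
    · refine mem_autOrbit_of_proj_eq_smul (-1) hg ?_
      rw [hgh, proj_inv, Units.val_neg, Units.val_one, neg_one_smul]

end Shear

end SmallAut

theorem mainTheorem3 :
    ∃ E : Set (commutator SmallAut.NilGroup), SmallAut.IsLebesgueNull E ∧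
      ∀ θ : commutator SmallAut.NilGroup, θ ∉ E →
        IsClosed (commutator (SmallAut.Quo θ) : Set (SmallAut.Quo θ)) ∧
        (∀ τ : SmallAut.Quo θ ≃ₜ* SmallAut.Quo θ,
          (∀ x, SmallAut.factor τ x = x) ∨ (∀ x, SmallAut.factor τ x = x⁻¹)) ∧
        (∀ g : SmallAut.Quo θ, g ∉ commutator (SmallAut.Quo θ) →
          SmallAut.autOrbit g =
            g • (commutator (SmallAut.Quo θ) : Set (SmallAut.Quo θ)) ∪
              g⁻¹ • (commutator (SmallAut.Quo θ) : Set (SmallAut.Quo θ)) ∧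
          g • (commutator (SmallAut.Quo θ) : Set (SmallAut.Quo θ)) ≠
            g⁻¹ • (commutator (SmallAut.Quo θ) : Set (SmallAut.Quo θ))) ∧
        (∀ g ∈ commutator (SmallAut.Quo θ), SmallAut.autOrbit g = {g}) := by
  refine ⟨{θ | (θ : SmallAut.NilGroup).log.2 ∈ SmallAut.degenerate}, ?_, fun θ hθ =>
    ⟨SmallAut.isClosed_commutator θ, SmallAut.factor_eq_self_or_inv hθ,
      fun g hg => ⟨SmallAut.autOrbit_eq_union hθ hg, SmallAut.smul_commutator_ne_inv_smul hg⟩,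
      fun g hg => SmallAut.autOrbit_eq_singleton hθ hg⟩⟩
  refine MeasureTheory.measure_mono_null ?_ SmallAut.volume_degenerate
  rintro _ ⟨θ, hθ, rfl⟩
  exact ⟨_, hθ, rfl⟩
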